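/- Let $\nu\neq 0$ be a $\sigma$-finite Borel measure on $\mathbb R$, let $N=\{u\in\mathbb R:\int e^{ux}\,\nu(dx)<\infty\}$ with interior $N^\circ$, and for $u\in N$ put $B(u)=\log\int e^{ux}\,\nu(dx)$ and $p_u(x)=e^{ux-B(u)}$. Let $\theta_0\in\mathbb R$, $c>0$, and let $\mu$ be an arbitrary probability measure (the prior) with $\mu(N^\circ)=1$ and $0<\mu((\theta_0,\infty))<1$. For $n\in\mathbb N_0=\{0,1,2,\dots\}$ put $$Y_n=\Big\{y\in\mathbb R:\int e^{uy-nB(u)}\,\mu(du)<\infty\Big\},$$ and for $y\in Y_n$ put $$\mu_{n,y}(du)=\frac{e^{uy-nB(u)}\,\mu(du)}{\int e^{vy-nB(v)}\,\mu(dv)},\qquad q(n,y)=\mu_{n,y}((\theta_0,\infty)).$$ Consider any $n$ for which $Y_n$ is open (for instance $Y_n=\mathbb R$; if $\int e^{uy}\,\mu(du)<\infty$ for all $y\in\mathbb R$, then $Y_n=\mathbb R$ for every $n$). Then $q(n,\cdot)$ is a bijection from $Y_n$ onto $(0,1)$. For $\pi\in(0,1)$ let $y(n,\pi)$ be the solution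 of $q(n,y(n,\pi))=\pi$, and let $\mathbb P_{n,\pi}$ be the probability measure under which $\Theta$ has law $\mu_{n,y(n,\pi)}$ and, given $\Theta=u$, the subsequent observations $X_{n+1},X_{n+2},\dots$ are i.i.d. with law $p_u\,d\nu$. Let $\mathcal F_k$ be the $\sigma$-algebra generated by $X_{n+1},\dots,X_{n+k}$ (trivial for $k=0$), let $\Pi_{n+k}=\mathbb P_{n,\pi}(\Theta>\theta_0\mid\mathcal F_k)$, and let $$V(n,\pi)=\inf_{\tau}\mathbb E_{n,\pi}\big[\min(\Pi_{n+\tau},1-\Pi_{n+\tau})+c\,\tau\big],$$ where $\tau$ runs over all $\mathbb N_0$-valued stopping times of $(\mathcal F_k)_{k\ge 0}$. Put $V(n,0)=V(n,1)=0$. Then, for every $n\in\mathbb N_0$ such that $Y_n$ is open, $\pi\mapsto V(n,\pi)$ is concave on $(0,1)$, and its extension is concave on $[0,1]$. Moreover, there are functions $b_1:\mathbb N_0\to[0,\tfrac12]$ and $b_2:\mathbb N_0\to[\tfrac12,1]$ such that, for every $n$ with $Y_n$ open, $$\{\pi\in[0,1]: V(n,\pi)<\min(\pi,1-\pi)\}=\{\pi: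 b_1(n)<\pi<b_2(n)\}.$$ In particular, if $Y_n$ is open for every $n$, then the continuation region $\mathcal C=\{(n,\pi)\in\mathbb N_0\times[0,1]:V(n,\pi)<\min(\pi,1-\pi)\}$ equals $\{(n,\pi)\in\mathbb N_0\times[0,1]: b_1(n)<\pi<b_2(n)\}$. -/

import Mathlib

open MeasureTheory ProbabilityTheory Set
open scoped ENNReal

namespace SeqTest

/-! ### The natural exponential family generated by `ν` -/

/-- The natural parameter set `N = {u : ∫ exp (u x) ν(dx) < ∞}`. -/
def paramSet (ν : Measure ℝ) : Set ℝ :=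
  {u | Integrable (fun x => Real.exp (u * x)) ν}

/-- `B(u) = log ∫ exp (u x) ν(dx)` (used only for `u` in `paramSet ν`). -/
noncomputable def B (ν : Measure ℝ) (u : ℝ) : ℝ :=
  Real.log (∫ x, Real.exp (u * x) ∂ν)

/-- The density `p_u(x) = exp (u x - B(u))`. -/
noncomputable def dens (ν : Measure ℝ) (u x : ℝ) : ℝ :=
  Real.exp (u * x - B ν u)

open Classical in
/-- The law `p_u dν` of one observation given `Θ = u`. For the irrelevant values of `u` at which
`p_u dν` is not a probability measure (the `u` outside `paramSet ν`), the value is `dirac 0`; see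
`obsLaw_eq`. -/
noncomputable def obsLaw (ν : Measure ℝ) (u : ℝ) : Measure ℝ :=
  if ν.withDensity (fun x => ENNReal.ofReal (dens ν u x)) univ = 1 then
    ν.withDensity (fun x => ENNReal.ofReal (dens ν u x))
  else Measure.dirac 0

instance instIsProbObsLaw (ν : Measure ℝ) (u : ℝ) : IsProbabilityMeasure (obsLaw ν u) := by
  unfold obsLaw
  split_ifs with h
  · exact ⟨h⟩
  · infer_instance

theorem obsLaw_eq {ν : Measure ℝ} (hν : ν ≠ 0) {u : ℝ} (hu : u ∈ paramSet ν) :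
    obsLaw ν u = ν.withDensity (fun x => ENNReal.ofReal (dens ν u x)) := by
  have hu' : Integrable (fun x => Real.exp (u * x)) ν := hu
  have : NeZero ν := ⟨hν⟩
  have hpos : 0 < ∫ x, Real.exp (u * x) ∂ν := integral_exp_pos hu'
  have hd : ∀ x, dens ν u x = Real.exp (u * x) / ∫ x, Real.exp (u * x) ∂ν := fun x => by
    rw [dens, B, Real.exp_sub, Real.exp_log hpos]
  unfold obsLaw
  rw [if_pos]
  rw [withDensity_apply _ MeasurableSet.univ, Measure.restrict_univ,
    ← ofReal_integral_eq_lintegral_ofReal]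
  · simp only [hd]
    rw [integral_div, div_self hpos.ne', ENNReal.ofReal_one]
  · exact (hu'.div_const _).congr (Filter.Eventually.of_forall fun x => (hd x).symm)
  · exact Filter.Eventually.of_forall fun x => (Real.exp_pos _).le

theorem measurable_B (ν : Measure ℝ) [SFinite ν] : Measurable (B ν) := by
  refine Real.measurable_log.comp ?_
  have h : StronglyMeasurable (Function.uncurry fun u x : ℝ => Real.exp (u * x)) :=
    (by fun_prop : Measurable fun p : ℝ × ℝ => Real.exp (p.1 * p.2)).stronglyMeasurable
  exact h.integral_prod_right.measurable

theorem measurable_dens (ν : Measure ℝ) [SFinite ν] :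
    Measurable (Function.uncurry fun u x : ℝ => ENNReal.ofReal (dens ν u x)) := by
  have := measurable_B ν
  unfold dens
  fun_prop

theorem measurable_obsLaw (ν : Measure ℝ) [SFinite ν] : Measurable (obsLaw ν) := by
  have hm := measurable_dens ν
  have hs : ∀ s : Set ℝ, MeasurableSet s →
      Measurable fun u => ν.withDensity (fun x => ENNReal.ofReal (dens ν u x)) s := by
    intro s hs
    simp only [withDensity_apply _ hs]
    exact hm.lintegral_prod_right'
  refine Measure.measurable_of_measurable_coe _ fun s hs' => ?_
  have : (fun u => obsLaw ν u s) = fun u =>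
      if ν.withDensity (fun x => ENNReal.ofReal (dens ν u x)) univ = 1 then
        ν.withDensity (fun x => ENNReal.ofReal (dens ν u x)) s
      else Measure.dirac 0 s := by
    funext u
    unfold obsLaw
    split_ifs <;> rfl
  rw [this]
  exact Measurable.ite (hs univ MeasurableSet.univ (measurableSet_singleton 1)) (hs s hs')
    measurable_const

/-- The kernel that sends `u` to the law of an i.i.d. sequence with common law `obsLaw ν u`. -/
noncomputable def seqKernel (ν : Measure ℝ) [SFinite ν] : Kernel ℝ (ℕ → ℝ) where
  toFun u := Measure.infinitePi fun _ : ℕ => obsLaw ν u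
  measurable' := by
    refine Measurable.measure_of_isPiSystem_of_isProbabilityMeasure
      generateFrom_squareCylinders.symm
      (isPiSystem_squareCylinders (fun _ => MeasurableSpace.isPiSystem_measurableSet) (by simp)) ?_
    rintro _ ⟨I, t, ht, rfl⟩
    have ht' : ∀ i, MeasurableSet (t i) := fun i => ht i (mem_univ i)
    have : ∀ u, (Measure.infinitePi fun _ : ℕ => obsLaw ν u) ((I : Set ℕ).pi t)
        = ∏ i ∈ I, obsLaw ν u (t i) := fun u =>
      Measure.infinitePi_pi _ fun i _ => ht' i
    simp only [this]
    exact Finset.measurable_prod _ fun i _ =>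
      (Measure.measurable_coe (ht' i)).comp (measurable_obsLaw ν)

instance instIsMarkovSeqKernel (ν : Measure ℝ) [SFinite ν] : IsMarkovKernel (seqKernel ν) :=
  ⟨fun u => inferInstanceAs (IsProbabilityMeasure (Measure.infinitePi fun _ : ℕ => obsLaw ν u))⟩

/-! ### Posterior distributions and level curves -/

/-- The set of `y` for which the normalising integral `∫ exp (u y - n B(u)) μ(du)` is finite, i.e.
for which the posterior distribution `μ_{n,y}` is defined. -/
def finiteSet (ν μ : Measure ℝ) (n : ℕ) : Set ℝ :=
  {y | Integrable (fun u => Real.exp (u * y - n * B ν u)) μ}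

/-- The posterior distribution
`μ_{n,y}(du) = exp (u y - n B(u)) μ(du) / ∫ exp (u y - n B(u)) μ(du)` of `Θ` at time `n`, given that
the first `n` observations sum to `y`. (It is `0` for `y` outside `finiteSet ν μ n`.) -/
noncomputable def posterior (ν μ : Measure ℝ) (n : ℕ) (y : ℝ) : Measure ℝ :=
  μ.tilted fun u => u * y - n * B ν u

/-- `q(n,y) = μ_{n,y}(Θ > θ₀)`. -/
noncomputable def q (ν μ : Measure ℝ) (θ₀ : ℝ) (n : ℕ) (y : ℝ) : ℝ :=
  (posterior ν μ n y).real (Ioi θ₀)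

/-- `y(n,π)`: the solution `y` of `q(n,y) = π`. -/
noncomputable def level (ν μ : Measure ℝ) (θ₀ : ℝ) (n : ℕ) (p : ℝ) : ℝ :=
  Function.invFun (q ν μ θ₀ n) p

/-! ### The stopping problem

The sample space is `ℝ × (ℕ → ℝ)`; the first coordinate of `ω` is `Θ`, and `ω.2 i` is the
`(i+1)`-th observation made after the starting time. -/

/-- The measure `P_{n,π}`: the law of `Θ` is `μ_{n,y(n,π)}` and, given `Θ = u`, the future
observations are i.i.d. with law `p_u dν`. -/
noncomputable def startLaw (ν μ : Measure ℝ) [SFinite ν] (θ₀ : ℝ) (n : ℕ) (p : ℝ) :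
    Measure (ℝ × (ℕ → ℝ)) :=
  (posterior ν μ n (level ν μ θ₀ n p)).compProd (seqKernel ν)

/-- The observation filtration: at time `k` the first `k` observations are known; in particular it
is trivial at time `0`. -/
def obsFiltration : Filtration ℕ (inferInstance : MeasurableSpace (ℝ × (ℕ → ℝ))) where
  seq k := MeasurableSpace.comap (fun ω (i : Fin k) => ω.2 i) inferInstance
  mono' := by
    intro k l hkl
    have h : (fun (ω : ℝ × (ℕ → ℝ)) (i : Fin k) => ω.2 i)
        = (fun (z : Fin l → ℝ) (i : Fin k) => z (Fin.castLE hkl i)) ∘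
          fun ω (i : Fin l) => ω.2 i := rfl
    simp only
    rw [h, ← MeasurableSpace.comap_comp]
    exact MeasurableSpace.comap_mono
      (measurable_pi_lambda _ fun i => measurable_pi_apply _).comap_le
  le' := fun k => Measurable.comap_le (by fun_prop)

/-- The posterior probability process under `P_{n,π}`:
`postProb ν μ θ₀ n π k` is `Π_{n+k} = P_{n,π}(Θ > θ₀ | F_k)`. -/
noncomputable def postProb (ν μ : Measure ℝ) [SFinite ν] (θ₀ : ℝ) (n : ℕ) (p : ℝ) (k : ℕ) :
    ℝ × (ℕ → ℝ) → ℝ :=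
  (startLaw ν μ θ₀ n p)[indicator {ω | θ₀ < ω.1} (fun _ => (1 : ℝ)) | obsFiltration k]

/-- The expected cost `E_{n,π}[Π_{n+τ} ∧ (1 - Π_{n+τ}) + c τ]`, in `[0,∞]`. -/
noncomputable def cost (ν μ : Measure ℝ) [SFinite ν] (θ₀ c : ℝ) (n : ℕ) (p : ℝ)
    (τ : ℝ × (ℕ → ℝ) → ℕ) : ℝ≥0∞ :=
  ∫⁻ ω, ENNReal.ofReal
    (min (postProb ν μ θ₀ n p (τ ω) ω) (1 - postProb ν μ θ₀ n p (τ ω) ω) + c * τ ω)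
    ∂(startLaw ν μ θ₀ n p)

/-- The embedded cost function `V(n,π)`: the infimum of the expected cost over all stopping times of
the observation filtration with values in `{0,1,2,…}`. -/
noncomputable def V (ν μ : Measure ℝ) [SFinite ν] (θ₀ c : ℝ) (n : ℕ) (p : ℝ) : ℝ :=
  (⨅ (τ : ℝ × (ℕ → ℝ) → ℕ) (_ : IsStoppingTime obsFiltration fun ω => (τ ω : WithTop ℕ)),
    cost ν μ θ₀ c n p τ).toReal

/-- The extension of `V(n,·)` from `(0,1)` to `[0,1]` by `V(n,0) = V(n,1) = 0`. -/
noncomputable def Vext (ν μ : Measure ℝ) [SFinite ν] (θ₀ c : ℝ) (n : ℕ) (p : ℝ) : ℝ :=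
  if p = 0 ∨ p = 1 then 0 else V ν μ θ₀ c n p

/-- The continuation region `C = {(n,π) ∈ ℕ × [0,1] : V(n,π) < π ∧ (1 - π)}`. -/
def contRegion (ν μ : Measure ℝ) [SFinite ν] (θ₀ c : ℝ) : Set (ℕ × ℝ) :=
  {z | z.2 ∈ Icc (0 : ℝ) 1 ∧ Vext ν μ θ₀ c z.1 z.2 < min z.2 (1 - z.2)}

end SeqTest

/-! The pair (n, y), with y the sum of the observations, is a sufficient Markov state, and on
`finiteSet ν μ n` the posterior probability `q` is strictly increasing in y. The value is the
infimum over k of the finite-horizon values `val`, so it suffices that each `val` is concave in the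
coordinate `q` (`QConcave`). Minima preserve this; the crux is the one-step expectation
(`QConcave.integral`).

Suppose the next-stage cost is F(`q`) with F concave, and `q` at y₀ is a mixture of `q` at y₁ and
y₂. For each next observation x, bound F by its tangent line at `q (n+1) (y₀+x)`, with value A(x) at
0 and A(x)+D(x) at 1. The bound is exact when starting from y₀. Since `q` is a conditional
probability of Θ > θ₀, the expected tangent value is the posterior integral of one function of u
that does not depend on the starting state: E_u A for u ≤ θ₀ and E_u (A+D) for u > θ₀. As x grows
the contact point moves right, so A increases and A+D decreases; by the monotone likelihood ratio
this `risk` increases up to θ₀ and decreases beyond it (`risk_monotoneOn`, `risk_antitoneOn`).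

The mixture of the posteriors at y₁ and y₂ has the same mass on either side of θ₀ as the posterior
at y₀. Divided by the density at y₀, the mixed density is a convex combination of exponentials in u
up to constants, so it lies below the density at y₀ on an interval meeting both sides of θ₀. The
mixture thus moves mass away from θ₀ and lowers the integral of `risk`
(`integral_posterior_mix_le`). This is the required concavity for Lipschitz F; Lipschitz envelopes
and dominated convergence give the general case.

The shape of the continuation region then follows from concavity and the bound by min(π, 1-π). -/

namespace SeqTest

/-! ### Bayes' rule: the posterior and the joint law of parameter and next observation. -/

section Bayes

variable {ν μ : Measure ℝ}

/-- The unnormalised posterior density `exp (u y - n B(u))`. -/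
noncomputable def wt (ν : Measure ℝ) (n : ℕ) (y u : ℝ) : ℝ≥0∞ :=
  ENNReal.ofReal (Real.exp (u * y - n * B ν u))

/-- The normalising constant of the posterior distribution. -/
noncomputable def mass (ν μ : Measure ℝ) (n : ℕ) (y : ℝ) : ℝ≥0∞ :=
  ∫⁻ u, wt ν n y u ∂μ

theorem measurable_wt [SFinite ν] (n : ℕ) :
    Measurable fun p : ℝ × ℝ => wt ν n p.1 p.2 := by
  have := measurable_B ν
  unfold wt
  fun_prop

theorem measurable_wt_right [SFinite ν] (n : ℕ) (y : ℝ) : Measurable (wt ν n y) :=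
  (measurable_wt n).comp (measurable_const.prodMk measurable_id)

theorem measurable_mass [SFinite ν] [SFinite μ] (n : ℕ) : Measurable (mass ν μ n) :=
  (measurable_wt n).lintegral_prod_right'

theorem wt_pos (n : ℕ) (y u : ℝ) : 0 < wt ν n y u :=
  ENNReal.ofReal_pos.2 (Real.exp_pos _)

theorem mass_ne_zero [SFinite ν] [NeZero μ] (n : ℕ) (y : ℝ) : mass ν μ n y ≠ 0 := by
  unfold mass
  rw [Ne, lintegral_eq_zero_iff (measurable_wt_right n y)]
  intro h
  have : ∀ᵐ u ∂μ, False := h.mono fun u hu => (wt_pos (ν := ν) n y u).ne' hu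
  simp only [Filter.eventually_false_iff_eq_bot, ae_eq_bot] at this
  exact NeZero.ne μ this

theorem mem_finiteSet_iff [SFinite ν] (n : ℕ) (y : ℝ) :
    y ∈ finiteSet ν μ n ↔ mass ν μ n y ≠ ∞ := by
  have hm := measurable_B ν
  have : AEStronglyMeasurable (fun u => Real.exp (u * y - n * B ν u)) μ :=
    (by fun_prop : Measurable _).aestronglyMeasurable
  rw [finiteSet, mem_ofPred_eq, ← lt_top_iff_ne_top, mass, Integrable, and_iff_right this,
    hasFiniteIntegral_iff_ofReal (Filter.Eventually.of_forall fun u => (Real.exp_pos _).le)]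
  rfl

theorem integral_exp_eq_mass [SFinite ν] (n : ℕ) (y : ℝ) :
    ∫ u, Real.exp (u * y - n * B ν u) ∂μ = (mass ν μ n y).toReal := by
  have hm := measurable_B ν
  rw [integral_eq_lintegral_of_nonneg_ae (Filter.Eventually.of_forall fun u => (Real.exp_pos _).le)
    (by fun_prop : Measurable _).aestronglyMeasurable]
  rfl

/-- The posterior density with respect to the prior. -/
noncomputable def postDens (ν μ : Measure ℝ) (n : ℕ) (y u : ℝ) : ℝ :=
  Real.exp (u * y - n * B ν u) / (mass ν μ n y).toReal

theorem posterior_eq [SFinite ν] (n : ℕ) (y : ℝ) :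
    posterior ν μ n y = μ.withDensity fun u => ENNReal.ofReal (postDens ν μ n y u) := by
  unfold posterior Measure.tilted postDens
  rw [integral_exp_eq_mass]

theorem measurable_postDens [SFinite ν] [SFinite μ] (n : ℕ) :
    Measurable fun p : ℝ × ℝ => postDens ν μ n p.1 p.2 := by
  have := measurable_B ν
  have := measurable_mass (ν := ν) (μ := μ) n
  unfold postDens
  fun_prop

theorem measurable_postDens_right [SFinite ν] [SFinite μ] (n : ℕ) (y : ℝ) :
    Measurable (postDens ν μ n y) :=
  (measurable_postDens n).comp (measurable_const.prodMk measurable_id)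

theorem lintegral_posterior [SFinite ν] [SFinite μ] (n : ℕ) (y : ℝ) {f : ℝ → ℝ≥0∞}
    (hf : Measurable f) :
    ∫⁻ u, f u ∂posterior ν μ n y = ∫⁻ u, ENNReal.ofReal (postDens ν μ n y u) * f u ∂μ := by
  rw [posterior_eq, lintegral_withDensity_eq_lintegral_mul _
    (measurable_postDens_right n y).ennreal_ofReal hf]
  rfl

theorem ofReal_postDens [SFinite ν] [NeZero μ] {n : ℕ} {y : ℝ} (hy : y ∈ finiteSet ν μ n) (u : ℝ) :
    ENNReal.ofReal (postDens ν μ n y u) = (mass ν μ n y)⁻¹ * wt ν n y u := by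
  have h := (mem_finiteSet_iff n y).1 hy
  rw [postDens, ENNReal.ofReal_div_of_pos (ENNReal.toReal_pos (mass_ne_zero n y) h),
    ENNReal.ofReal_toReal h, ENNReal.div_eq_inv_mul, wt]

theorem lintegral_posterior_of_mem [SFinite ν] [SFinite μ] [NeZero μ] {n : ℕ} {y : ℝ}
    (hy : y ∈ finiteSet ν μ n) {f : ℝ → ℝ≥0∞} (hf : Measurable f) :
    ∫⁻ u, f u ∂posterior ν μ n y = (mass ν μ n y)⁻¹ * ∫⁻ u, wt ν n y u * f u ∂μ := by
  have hm : Measurable fun u => wt ν n y u * f u := (measurable_wt_right n y).mul hf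
  rw [lintegral_posterior n y hf, ← lintegral_const_mul _ hm]
  simp only [ofReal_postDens hy, mul_assoc]

instance isZeroOrProb_posterior (n : ℕ) (y : ℝ) :
    IsZeroOrProbabilityMeasure (posterior ν μ n y) := by
  unfold posterior; infer_instance

theorem isProb_posterior [NeZero μ] {n : ℕ} {y : ℝ} (hy : y ∈ finiteSet ν μ n) :
    IsProbabilityMeasure (posterior ν μ n y) :=
  isProbabilityMeasure_tilted hy

theorem posterior_of_notMem {n : ℕ} {y : ℝ} (hy : y ∉ finiteSet ν μ n) :
    posterior ν μ n y = 0 :=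
  tilted_of_not_integrable hy

theorem measurable_posterior [SFinite ν] [SFinite μ] (n : ℕ) :
    Measurable (posterior ν μ n) := by
  refine Measure.measurable_of_measurable_coe _ fun s hs => ?_
  have : (fun y => posterior ν μ n y s) =
      fun y => ∫⁻ u in s, ENNReal.ofReal (postDens ν μ n y u) ∂μ := by
    funext y
    rw [posterior_eq, withDensity_apply _ hs]
  rw [this]
  exact (measurable_postDens n).ennreal_ofReal.lintegral_prod_right'

/-- The posterior distribution as a kernel in the sufficient statistic. -/
noncomputable def postKernel (ν μ : Measure ℝ) [SFinite ν] [SFinite μ] (n : ℕ) : Kernel ℝ ℝ :=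
  ⟨posterior ν μ n, measurable_posterior n⟩

instance isFiniteKernel_postKernel [SFinite ν] [SFinite μ] (n : ℕ) :
    IsFiniteKernel (postKernel ν μ n) :=
  ⟨1, ENNReal.one_lt_top, fun y => prob_le_one (μ := posterior ν μ n y)⟩

/-- The law of one observation as a kernel in the parameter. -/
noncomputable def obsKernel (ν : Measure ℝ) [SFinite ν] : Kernel ℝ ℝ :=
  ⟨obsLaw ν, measurable_obsLaw ν⟩

instance isMarkovKernel_obsKernel [SFinite ν] : IsMarkovKernel (obsKernel ν) :=
  ⟨fun u => instIsProbObsLaw ν u⟩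

/-- The joint law of the parameter and the next observation. -/
noncomputable def joint (ν μ : Measure ℝ) [SFinite ν] (n : ℕ) (y : ℝ) : Measure (ℝ × ℝ) :=
  (posterior ν μ n y).compProd (obsKernel ν)

instance isFiniteMeasure_joint [SFinite ν] (n : ℕ) (y : ℝ) : IsFiniteMeasure (joint ν μ n y) := by
  unfold joint; infer_instance

theorem isProb_joint [SFinite ν] [NeZero μ] {n : ℕ} {y : ℝ} (hy : y ∈ finiteSet ν μ n) :
    IsProbabilityMeasure (joint ν μ n y) := by
  have := isProb_posterior hy
  unfold joint; infer_instance

theorem joint_of_notMem [SFinite ν] {n : ℕ} {y : ℝ} (hy : y ∉ finiteSet ν μ n) :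
    joint ν μ n y = 0 := by
  rw [joint, posterior_of_notMem hy, Measure.compProd_zero_left]

theorem measurable_joint [SFinite ν] [SFinite μ] (n : ℕ) : Measurable (joint ν μ n) := by
  have : joint ν μ n = (postKernel ν μ n ⊗ₖ Kernel.prodMkLeft ℝ (obsKernel ν)) := by
    funext y
    ext s hs
    rw [joint, Measure.compProd_apply hs, Kernel.compProd_apply hs]
    rfl
  rw [this]
  exact Kernel.measurable _

/-- The joint law of the parameter and the next observation, as a kernel in the sufficient
statistic. -/
noncomputable def jointKernel (ν μ : Measure ℝ) [SFinite ν] [SFinite μ] (n : ℕ) :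
    Kernel ℝ (ℝ × ℝ) :=
  ⟨joint ν μ n, measurable_joint n⟩

instance isFiniteKernel_jointKernel [SFinite ν] [SFinite μ] (n : ℕ) :
    IsFiniteKernel (jointKernel ν μ n) := by
  refine ⟨1, ENNReal.one_lt_top, fun y => ?_⟩
  change joint ν μ n y univ ≤ 1
  rw [joint, Measure.compProd_apply_univ]
  exact prob_le_one

theorem lintegral_obsLaw (hν : ν ≠ 0) [SFinite ν] {u : ℝ} (hu : u ∈ paramSet ν) {f : ℝ → ℝ≥0∞}
    (hf : Measurable f) :
    ∫⁻ x, f x ∂obsLaw ν u = ∫⁻ x, ENNReal.ofReal (dens ν u x) * f x ∂ν := by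
  rw [obsLaw_eq hν hu, lintegral_withDensity_eq_lintegral_mul _ _ hf]
  · rfl
  · exact (measurable_dens ν).comp (measurable_const.prodMk measurable_id)

/-- Conjugacy: multiplying by the likelihood only updates (n, y), which is what makes (n, y) a
sufficient state. -/
theorem wt_mul_dens (n : ℕ) (y u x : ℝ) :
    wt ν n y u * ENNReal.ofReal (dens ν u x) = wt ν (n + 1) (y + x) u := by
  rw [wt, dens, wt, ← ENNReal.ofReal_mul (Real.exp_pos _).le, ← Real.exp_add]
  congr 2
  push_cast
  ring

theorem lintegral_joint (hν : ν ≠ 0) [SFinite ν] [SFinite μ] [NeZero μ]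
    (hμ : ∀ᵐ u ∂μ, u ∈ paramSet ν) {n : ℕ} {y : ℝ} (hy : y ∈ finiteSet ν μ n)
    {G : ℝ × ℝ → ℝ≥0∞} (hG : Measurable G) :
    ∫⁻ z, G z ∂joint ν μ n y =
      (mass ν μ n y)⁻¹ * ∫⁻ x, ∫⁻ u, wt ν (n + 1) (y + x) u * G (u, x) ∂μ ∂ν := by
  have hm : Measurable fun p : ℝ × ℝ => wt ν (n + 1) (y + p.1) p.2 * G (p.2, p.1) :=
    ((measurable_wt (n + 1)).comp
      ((measurable_const.add measurable_fst).prodMk measurable_snd)).mul (hG.comp measurable_swap)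
  rw [joint, Measure.lintegral_compProd hG, lintegral_posterior_of_mem hy
    hG.lintegral_kernel_prod_right', lintegral_lintegral_swap hm.aemeasurable]
  congr 1
  refine lintegral_congr_ae ?_
  filter_upwards [hμ] with u hu
  change wt ν n y u * ∫⁻ x, G (u, x) ∂obsLaw ν u = _
  have hGu : Measurable fun x => G (u, x) := hG.comp (measurable_const.prodMk measurable_id)
  have hd : Measurable fun x => ENNReal.ofReal (dens ν u x) :=
    (measurable_dens ν).comp (measurable_const.prodMk measurable_id)
  have hdG : Measurable fun x => ENNReal.ofReal (dens ν u x) * G (u, x) := hd.mul hGu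
  rw [lintegral_obsLaw hν hu hGu, ← lintegral_const_mul _ hdG]
  refine lintegral_congr fun x => ?_
  rw [← mul_assoc, wt_mul_dens]

/-- The joint law has total mass one, so `lintegral_joint` with `G = 1` shows that x ↦ `mass ν μ (n
+ 1) (y + x)` has finite integral; hence it is finite almost everywhere. -/
theorem ae_add_mem_finiteSet (hν : ν ≠ 0) [SFinite ν] [SFinite μ] [NeZero μ]
    (hμ : ∀ᵐ u ∂μ, u ∈ paramSet ν) {n : ℕ} {y : ℝ} (hy : y ∈ finiteSet ν μ n) :
    ∀ᵐ x ∂ν, y + x ∈ finiteSet ν μ (n + 1) := by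
  have h := lintegral_joint hν hμ hy (G := fun _ => 1) measurable_const
  have hp := isProb_joint hy
  simp only [mul_one, lintegral_one, measure_univ] at h
  have hfin : ∫⁻ x, mass ν μ (n + 1) (y + x) ∂ν ≠ ∞ := by
    intro htop
    unfold mass at htop
    rw [htop, ENNReal.mul_top] at h
    · exact ENNReal.one_ne_top h
    · exact ENNReal.inv_ne_zero.2 ((mem_finiteSet_iff n y).1 hy)
  filter_upwards [ae_lt_top ((measurable_mass (n + 1)).comp (measurable_const_add y)) hfin]
    with x hx
  exact (mem_finiteSet_iff _ _).2 hx.ne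

/-- The marginal law of the next observation is absolutely continuous with respect to ν; off
`finiteSet` the joint law is zero. -/
theorem ae_joint_of_ae (hν : ν ≠ 0) [SFinite ν] [SFinite μ] [NeZero μ]
    (hμ : ∀ᵐ u ∂μ, u ∈ paramSet ν) {n : ℕ} {y : ℝ}
    {p : ℝ → Prop} (hp : ∀ᵐ x ∂ν, p x) : ∀ᵐ z ∂joint ν μ n y, p z.2 := by
  by_cases hy : y ∈ finiteSet ν μ n
  swap
  · simp [joint_of_notMem hy]
  obtain ⟨t, hsub, ht, ht0⟩ := exists_measurable_superset_of_null (ae_iff.1 hp)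
  have h := lintegral_joint hν hμ hy (G := fun z => t.indicator 1 z.2)
    ((measurable_one.indicator ht).comp measurable_snd)
  have h0 : ∫⁻ x, ∫⁻ u, wt ν (n + 1) (y + x) u * t.indicator 1 x ∂μ ∂ν = 0 := by
    refine (lintegral_congr_ae ?_).trans lintegral_zero
    have : ∀ᵐ x ∂ν, x ∉ t := measure_eq_zero_iff_ae_notMem.1 ht0
    filter_upwards [this] with x hx
    simp [hx]
  simp only [h0, mul_zero] at h
  have hi : Measurable fun z : ℝ × ℝ => t.indicator (1 : ℝ → ℝ≥0∞) z.2 :=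
    (measurable_one.indicator ht).comp measurable_snd
  rw [lintegral_eq_zero_iff hi] at h
  filter_upwards [h] with z hz
  by_contra hcon
  have : z.2 ∈ t := hsub hcon
  simp [this] at hz

/-- Bayes' formula: conditionally on the next observation `x`, the parameter has the posterior
distribution with parameters `n + 1` and `y + x`. -/
theorem lintegral_joint_posterior (hν : ν ≠ 0) [SFinite ν] [SFinite μ] [NeZero μ]
    (hμ : ∀ᵐ u ∂μ, u ∈ paramSet ν) {n : ℕ} {y : ℝ} (hy : y ∈ finiteSet ν μ n)
    {G : ℝ × ℝ → ℝ≥0∞} (hG : Measurable G) :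
    ∫⁻ z, G z ∂joint ν μ n y =
      ∫⁻ z, ∫⁻ u, G (u, z.2) ∂posterior ν μ (n + 1) (y + z.2) ∂joint ν μ n y := by
  have hH : Measurable fun z : ℝ × ℝ => ∫⁻ u, G (u, z.2) ∂posterior ν μ (n + 1) (y + z.2) := by
    have h1 : (fun z : ℝ × ℝ => ∫⁻ u, G (u, z.2) ∂posterior ν μ (n + 1) (y + z.2)) =
        fun z => ∫⁻ u, ENNReal.ofReal (postDens ν μ (n + 1) (y + z.2) u) * G (u, z.2) ∂μ :=
      funext fun z => lintegral_posterior _ _ (hG.comp (measurable_id.prodMk measurable_const))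
    have h2 : Measurable fun q : (ℝ × ℝ) × ℝ =>
        ENNReal.ofReal (postDens ν μ (n + 1) (y + q.1.2) q.2) * G (q.2, q.1.2) :=
      ((measurable_postDens (n + 1)).comp (((measurable_snd.comp measurable_fst).const_add
        y).prodMk measurable_snd)).ennreal_ofReal.mul
        (hG.comp (measurable_snd.prodMk (measurable_snd.comp measurable_fst)))
    rw [h1]
    exact h2.lintegral_prod_right'
  rw [lintegral_joint hν hμ hy hG, lintegral_joint hν hμ hy hH]
  congr 1
  refine lintegral_congr_ae ?_
  filter_upwards [ae_add_mem_finiteSet hν hμ hy] with x hx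
  have hGx : Measurable fun u => G (u, x) := hG.comp (measurable_id.prodMk measurable_const)
  rw [lintegral_mul_const _ (measurable_wt_right _ _), lintegral_posterior_of_mem hx hGx]
  change _ = mass ν μ (n + 1) (y + x) * _
  rw [← mul_assoc, ENNReal.mul_inv_cancel (mass_ne_zero _ _) ((mem_finiteSet_iff _ _).1 hx), one_mul]

end Bayes

/-! ### The map `q` in y: monotonicity, continuity and range. -/

section LevelCurves

variable {ν μ : Measure ℝ}

/-- The unnormalised posterior density, centred at `θ₀`. -/
noncomputable def cwt (ν : Measure ℝ) (θ₀ : ℝ) (n : ℕ) (y u : ℝ) : ℝ≥0∞ :=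
  ENNReal.ofReal (Real.exp ((u - θ₀) * y - n * B ν u))

/-- The centred unnormalised posterior measure of the set `S`. -/
noncomputable def cmass (ν μ : Measure ℝ) (θ₀ : ℝ) (n : ℕ) (S : Set ℝ) (y : ℝ) : ℝ≥0∞ :=
  ∫⁻ u in S, cwt ν θ₀ n y u ∂μ

theorem measurable_cwt [SFinite ν] (θ₀ : ℝ) (n : ℕ) (y : ℝ) : Measurable (cwt ν θ₀ n y) := by
  have := measurable_B ν
  unfold cwt
  fun_prop

theorem wt_eq_cwt (θ₀ : ℝ) (n : ℕ) (y u : ℝ) :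
    wt ν n y u = ENNReal.ofReal (Real.exp (θ₀ * y)) * cwt ν θ₀ n y u := by
  rw [wt, cwt, ← ENNReal.ofReal_mul (Real.exp_pos _).le, ← Real.exp_add]
  congr 2
  ring

/-- The reason for centring at θ₀: the side of θ₀ on which u lies decides whether the weight rises
or falls in y. The factor exp(θ₀ y) cancels in `q`. -/
theorem cwt_le_cwt_of_gt {θ₀ u y y' : ℝ} (n : ℕ) (hu : θ₀ ≤ u) (h : y ≤ y') :
    cwt ν θ₀ n y u ≤ cwt ν θ₀ n y' u := by
  unfold cwt
  gcongr

theorem cwt_le_cwt_of_le {θ₀ u y y' : ℝ} (n : ℕ) (hu : u ≤ θ₀) (h : y ≤ y') :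
    cwt ν θ₀ n y' u ≤ cwt ν θ₀ n y u := by
  refine ENNReal.ofReal_le_ofReal (Real.exp_le_exp.2 ?_)
  nlinarith

theorem cwt_le_add {θ₀ u y y₁ y₂ : ℝ} (n : ℕ) (h1 : y₁ ≤ y) (h2 : y ≤ y₂) :
    cwt ν θ₀ n y u ≤ cwt ν θ₀ n y₁ u + cwt ν θ₀ n y₂ u := by
  rcases le_total θ₀ u with hu | hu
  · exact (cwt_le_cwt_of_gt n hu h2).trans le_add_self
  · exact (cwt_le_cwt_of_le n hu h1).trans le_self_add

theorem mass_eq_cmass [SFinite ν] (θ₀ : ℝ) (n : ℕ) (y : ℝ) :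
    mass ν μ n y = ENNReal.ofReal (Real.exp (θ₀ * y)) *
      (cmass ν μ θ₀ n (Ioi θ₀) y + cmass ν μ θ₀ n (Iic θ₀) y) := by
  have h := lintegral_add_compl (μ := μ) (cwt ν θ₀ n y) (measurableSet_Ioi (a := θ₀))
  rw [compl_Ioi] at h
  rw [cmass, cmass, h, ← lintegral_const_mul _ (measurable_cwt _ _ _)]
  exact lintegral_congr fun u => wt_eq_cwt θ₀ n y u

theorem mem_finiteSet_iff_cmass [SFinite ν] (θ₀ : ℝ) (n : ℕ) (y : ℝ) :
    y ∈ finiteSet ν μ n ↔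
      cmass ν μ θ₀ n (Ioi θ₀) y ≠ ∞ ∧ cmass ν μ θ₀ n (Iic θ₀) y ≠ ∞ := by
  rw [mem_finiteSet_iff, mass_eq_cmass θ₀, Ne, ENNReal.mul_eq_top]
  simp [Real.exp_pos, ENNReal.add_eq_top]

theorem cmass_mono_Ioi (θ₀ : ℝ) (n : ℕ) : Monotone (cmass ν μ θ₀ n (Ioi θ₀)) := fun _ _ h =>
  setLIntegral_mono' measurableSet_Ioi fun _ hu => cwt_le_cwt_of_gt n (le_of_lt hu) h

theorem cmass_anti_Iic (θ₀ : ℝ) (n : ℕ) : Antitone (cmass ν μ θ₀ n (Iic θ₀)) := fun _ _ h =>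
  setLIntegral_mono' measurableSet_Iic fun _ hu => cwt_le_cwt_of_le n hu h

theorem cmass_pos [SFinite ν] {S : Set ℝ} (hS : 0 < μ S) (θ₀ : ℝ) (n : ℕ) (y : ℝ) :
    0 < cmass ν μ θ₀ n S y := by
  rw [pos_iff_ne_zero, cmass, Ne, lintegral_eq_zero_iff (measurable_cwt _ _ _)]
  intro h
  have : ∀ᵐ u ∂μ.restrict S, False := h.mono fun u hu =>
    (ENNReal.ofReal_pos.2 (Real.exp_pos _)).ne' hu
  simp only [Filter.eventually_false_iff_eq_bot, ae_eq_bot, Measure.restrict_eq_zero] at this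
  exact hS.ne' this

/-- Any centre serves, so `0` is used: the mass above it is controlled by the right end point, the
mass below by the left one. -/
theorem ordConnected_finiteSet [SFinite ν] (n : ℕ) : (finiteSet ν μ n).OrdConnected := by
  refine ⟨fun a ha b hb y hy => ?_⟩
  rw [mem_finiteSet_iff_cmass 0] at *
  exact ⟨ne_top_of_le_ne_top hb.1 (cmass_mono_Ioi 0 n hy.2),
    ne_top_of_le_ne_top ha.2 (cmass_anti_Iic 0 n hy.1)⟩

theorem q_nonneg (θ₀ : ℝ) (n : ℕ) (y : ℝ) : 0 ≤ q ν μ θ₀ n y := measureReal_nonneg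

theorem q_le_one (θ₀ : ℝ) (n : ℕ) (y : ℝ) : q ν μ θ₀ n y ≤ 1 := by
  refine ENNReal.toReal_le_of_le_ofReal zero_le_one ?_
  simpa using prob_le_one (μ := posterior ν μ n y)

theorem measurable_q [SFinite ν] [SFinite μ] (θ₀ : ℝ) (n : ℕ) : Measurable (q ν μ θ₀ n) :=
  ((Measure.measurable_coe measurableSet_Ioi).comp (measurable_posterior n)).ennreal_toReal

theorem q_of_notMem (θ₀ : ℝ) {n : ℕ} {y : ℝ} (hy : y ∉ finiteSet ν μ n) : q ν μ θ₀ n y = 0 := by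
  simp [q, posterior_of_notMem hy]

theorem q_eq [SFinite ν] [SFinite μ] [NeZero μ] (θ₀ : ℝ) {n : ℕ} {y : ℝ}
    (hy : y ∈ finiteSet ν μ n) :
    q ν μ θ₀ n y = (cmass ν μ θ₀ n (Ioi θ₀) y).toReal /
      ((cmass ν μ θ₀ n (Ioi θ₀) y).toReal + (cmass ν μ θ₀ n (Iic θ₀) y).toReal) := by
  have hf := (mem_finiteSet_iff_cmass θ₀ n y).1 hy
  have h : posterior ν μ n y (Ioi θ₀) = (mass ν μ n y)⁻¹ *
      (ENNReal.ofReal (Real.exp (θ₀ * y)) * cmass ν μ θ₀ n (Ioi θ₀) y) := by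
    have h1 := lintegral_posterior_of_mem hy (f := (Ioi θ₀).indicator 1)
      (measurable_one.indicator measurableSet_Ioi)
    rw [lintegral_indicator_one measurableSet_Ioi] at h1
    rw [h1, cmass, ← lintegral_const_mul _ (measurable_cwt _ _ _),
      ← lintegral_indicator measurableSet_Ioi]
    congr 1
    refine lintegral_congr fun u => ?_
    by_cases hu : u ∈ Ioi θ₀ <;> simp [hu, wt_eq_cwt θ₀]
  have hK : (Real.exp (θ₀ * y)) ≠ 0 := (Real.exp_pos _).ne'
  rw [q, measureReal_def, h, mass_eq_cmass θ₀]
  simp only [ENNReal.toReal_mul, ENNReal.toReal_inv, ENNReal.toReal_add hf.1 hf.2,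
    ENNReal.toReal_ofReal (Real.exp_pos _).le]
  rw [mul_inv, div_eq_inv_mul]
  field_simp

/-- As y grows, the centred mass above θ₀ rises strictly while the mass at or below θ₀ does not
rise. The latter need not fall strictly, since it may sit at θ₀. -/
theorem strictMonoOn_q [SFinite ν] [SFinite μ] [NeZero μ] {θ₀ : ℝ} (h0 : 0 < μ (Ioi θ₀))
    (h1 : 0 < μ (Iic θ₀)) (n : ℕ) : StrictMonoOn (q ν μ θ₀ n) (finiteSet ν μ n) := by
  intro y hy y' hy' h
  have hf := (mem_finiteSet_iff_cmass θ₀ n y).1 hy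
  have hf' := (mem_finiteSet_iff_cmass θ₀ n y').1 hy'
  have hlt : cmass ν μ θ₀ n (Ioi θ₀) y < cmass ν μ θ₀ n (Ioi θ₀) y' := by
    refine lintegral_strict_mono (by simpa using h0.ne') (measurable_cwt _ _ _).aemeasurable
      hf.1 ?_
    filter_upwards [ae_restrict_mem measurableSet_Ioi] with u hu
    refine (ENNReal.ofReal_lt_ofReal_iff (Real.exp_pos _)).2 (Real.exp_lt_exp.2 ?_)
    have : θ₀ < u := hu
    nlinarith
  have hle := cmass_anti_Iic (ν := ν) (μ := μ) θ₀ n h.le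
  have hp := ENNReal.toReal_pos (cmass_pos (ν := ν) h1 θ₀ n y').ne' hf'.2
  have hp' := ENNReal.toReal_pos (cmass_pos (ν := ν) h0 θ₀ n y).ne' hf.1
  have hle' := ENNReal.toReal_mono hf.2 hle
  have hlt' := (ENNReal.toReal_lt_toReal hf.1 hf'.1).2 hlt
  rw [q_eq θ₀ hy, q_eq θ₀ hy', div_lt_div_iff₀ (by linarith) (by linarith)]
  nlinarith

theorem q_pos [SFinite ν] [SFinite μ] [NeZero μ] {θ₀ : ℝ} (h0 : 0 < μ (Ioi θ₀))
    {n : ℕ} {y : ℝ} (hy : y ∈ finiteSet ν μ n) : 0 < q ν μ θ₀ n y := by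
  have hf := (mem_finiteSet_iff_cmass θ₀ n y).1 hy
  rw [q_eq θ₀ hy]
  have hp' := ENNReal.toReal_pos (cmass_pos (ν := ν) h0 θ₀ n y).ne' hf.1
  positivity

theorem continuousOn_q [SFinite ν] [SFinite μ] [NeZero μ] {θ₀ : ℝ} (h0 : 0 < μ (Ioi θ₀))
    (n : ℕ) : ContinuousOn (q ν μ θ₀ n) (interior (finiteSet ν μ n)) := by
  intro y hy
  refine ContinuousAt.continuousWithinAt ?_
  obtain ⟨a, b, hyab, hab, hsub⟩ := exists_Icc_mem_subset_of_mem_nhds (mem_interior_iff_mem_nhds.1 hy)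
  have ha : a ∈ finiteSet ν μ n := hsub (left_mem_Icc.2 (hyab.1.trans hyab.2))
  have hb : b ∈ finiteSet ν μ n := hsub (right_mem_Icc.2 (hyab.1.trans hyab.2))
  have hy' := interior_subset hy
  have hfa := (mem_finiteSet_iff_cmass θ₀ n a).1 ha
  have hfb := (mem_finiteSet_iff_cmass θ₀ n b).1 hb
  have hfy := (mem_finiteSet_iff_cmass θ₀ n y).1 hy'
  have key : ∀ S, cmass ν μ θ₀ n S a ≠ ∞ → cmass ν μ θ₀ n S b ≠ ∞ →
      Filter.Tendsto (cmass ν μ θ₀ n S) (nhds y) (nhds (cmass ν μ θ₀ n S y)) := by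
    intro S hSa hSb
    refine tendsto_lintegral_filter_of_dominated_convergence
      (fun u => cwt ν θ₀ n a u + cwt ν θ₀ n b u)
      (Filter.Eventually.of_forall fun y' => measurable_cwt _ _ _) ?_ ?_ ?_
    · filter_upwards [hab] with y' hy'
      exact Filter.Eventually.of_forall fun u => cwt_le_add n hy'.1 hy'.2
    · rw [lintegral_add_left (measurable_cwt _ _ _)]
      exact ENNReal.add_ne_top.2 ⟨hSa, hSb⟩
    · refine Filter.Eventually.of_forall fun u => ?_
      refine (ENNReal.continuous_ofReal.comp ?_).tendsto y
      fun_prop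
  have k1 := (ENNReal.tendsto_toReal hfy.1).comp (key (Ioi θ₀) hfa.1 hfb.1)
  have k2 := (ENNReal.tendsto_toReal hfy.2).comp (key (Iic θ₀) hfa.2 hfb.2)
  have hp' := ENNReal.toReal_pos (cmass_pos (ν := ν) h0 θ₀ n y).ne' hfy.1
  have k3 := k1.div (k1.add k2) (by positivity)
  have : Filter.Tendsto (q ν μ θ₀ n) (nhds y) (nhds (q ν μ θ₀ n y)) := by
    rw [q_eq θ₀ hy']
    refine k3.congr' ?_
    filter_upwards [hab] with y' hy'
    exact (q_eq θ₀ (hsub hy')).symm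
  exact this

/-- Monotone convergence allows an infinite limit, so this applies at an end point not known to lie
in `finiteSet`. -/
theorem tendsto_cmass [SFinite ν] (θ₀ : ℝ) (n : ℕ) {S : Set ℝ} {y : ℝ} {s : ℕ → ℝ}
    (hs : Filter.Tendsto s Filter.atTop (nhds y))
    (hmono : ∀ᵐ u ∂μ.restrict S, Monotone fun k => cwt ν θ₀ n (s k) u) :
    Filter.Tendsto (fun k => cmass ν μ θ₀ n S (s k)) Filter.atTop (nhds (cmass ν μ θ₀ n S y)) := by
  refine lintegral_tendsto_of_tendsto_of_monotone
    (fun k => (measurable_cwt _ _ _).aemeasurable) hmono ?_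
  refine Filter.Eventually.of_forall fun u => ?_
  have : Continuous fun y => cwt ν θ₀ n y u := by
    unfold cwt
    exact ENNReal.continuous_ofReal.comp (by fun_prop)
  exact (this.tendsto y).comp hs

/-- If `q` stayed at or below p, the mass above θ₀ would stay bounded as y increases. When Y_n is
bounded above, its supremum would then belong to it, against openness; otherwise the weights at u >
θ₀ tend to infinity, and so does that mass. -/
theorem exists_lt_q [SFinite ν] [SFinite μ] [NeZero μ] {θ₀ : ℝ} (h0 : 0 < μ (Ioi θ₀))
    {n : ℕ} (ho : IsOpen (finiteSet ν μ n)) (hne : (finiteSet ν μ n).Nonempty)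
    {p : ℝ} (hp : p < 1) : ∃ y ∈ finiteSet ν μ n, p < q ν μ θ₀ n y := by
  by_contra! hcon
  obtain ⟨y₀, hy₀⟩ := hne
  have hf₀ := (mem_finiteSet_iff_cmass θ₀ n y₀).1 hy₀
  obtain ⟨C, hC, hbd⟩ : ∃ C : ℝ≥0∞, C ≠ ∞ ∧
      ∀ y ∈ finiteSet ν μ n, y₀ ≤ y → cmass ν μ θ₀ n (Ioi θ₀) y ≤ C := by
    -- From α/(α+β) ≤ p one gets α ≤ p/(1-p) β, and β is at most its value at y₀.
    refine ⟨ENNReal.ofReal (p / (1 - p) * (cmass ν μ θ₀ n (Iic θ₀) y₀).toReal),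
      ENNReal.ofReal_ne_top, fun y hy hle => ?_⟩
    have hf := (mem_finiteSet_iff_cmass θ₀ n y).1 hy
    have h := hcon y hy
    have h1 := ENNReal.toReal_pos (cmass_pos (ν := ν) h0 θ₀ n y).ne' hf.1
    have h2 := ENNReal.toReal_mono hf₀.2 (cmass_anti_Iic (ν := ν) (μ := μ) θ₀ n hle)
    have h3 : 0 ≤ (cmass ν μ θ₀ n (Iic θ₀) y).toReal := ENNReal.toReal_nonneg
    have hq := q_pos (ν := ν) h0 hy
    rw [q_eq θ₀ hy, div_le_iff₀ (by linarith)] at h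
    rw [← ENNReal.ofReal_toReal hf.1]
    refine ENNReal.ofReal_le_ofReal ?_
    rw [div_mul_eq_mul_div, le_div_iff₀ (by linarith)]
    nlinarith [hcon y hy]
  by_cases hb : BddAbove (finiteSet ν μ n)
  · obtain ⟨s, hs, hst, hsm⟩ := exists_seq_tendsto_sSup ⟨y₀, hy₀⟩ hb
    have hy : sSup (finiteSet ν μ n) ∉ finiteSet ν μ n := fun hmem => by
      obtain ⟨z, hz1, hz2⟩ : (finiteSet ν μ n ∩ Ioi (sSup (finiteSet ν μ n))).Nonempty :=
        Filter.nonempty_of_mem (f := nhdsWithin _ (Ioi _))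
          (Filter.inter_mem (nhdsWithin_le_nhds (ho.mem_nhds hmem)) self_mem_nhdsWithin)
      exact absurd (le_csSup hb hz1) (not_le.2 hz2)
    have hle₀ : y₀ ≤ sSup (finiteSet ν μ n) := le_csSup hb hy₀
    refine hy ((mem_finiteSet_iff_cmass θ₀ n _).2
      ⟨?_, ne_top_of_le_ne_top hf₀.2 (cmass_anti_Iic θ₀ n hle₀)⟩)
    refine ne_top_of_le_ne_top hC ?_
    have ht := tendsto_cmass (ν := ν) (μ := μ) θ₀ n (S := Ioi θ₀) hst
      (by
        filter_upwards [ae_restrict_mem measurableSet_Ioi] with u hu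
        exact fun i j hij => cwt_le_cwt_of_gt n (le_of_lt hu) (hs hij))
    refine le_of_tendsto' ht fun k => ?_
    rcases le_total y₀ (s k) with h | h
    · exact hbd _ (hsm k) h
    · exact (cmass_mono_Ioi θ₀ n h).trans (hbd _ hy₀ le_rfl)
  · have hall : ∀ k : ℕ, cmass ν μ θ₀ n (Ioi θ₀) k ≤ C := by
      intro k
      rw [not_bddAbove_iff] at hb
      obtain ⟨z, hz, hkz⟩ := hb (max k y₀)
      exact (cmass_mono_Ioi θ₀ n ((le_max_left _ _).trans hkz.le)).trans
        (hbd z hz ((le_max_right _ _).trans hkz.le))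
    have ht : Filter.Tendsto (fun k : ℕ => cmass ν μ θ₀ n (Ioi θ₀) (k : ℝ)) Filter.atTop
        (nhds (∫⁻ _ in Ioi θ₀, ∞ ∂μ)) := by
      refine lintegral_tendsto_of_tendsto_of_monotone
        (fun k => (measurable_cwt _ _ _).aemeasurable) ?_ ?_
      · filter_upwards [ae_restrict_mem measurableSet_Ioi] with u hu
        exact fun i j hij => cwt_le_cwt_of_gt n (le_of_lt hu) (by exact_mod_cast hij)
      · filter_upwards [ae_restrict_mem measurableSet_Ioi] with u hu
        refine ENNReal.tendsto_ofReal_atTop.comp (Real.tendsto_exp_atTop.comp ?_)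
        refine Filter.tendsto_atTop_add_const_right _ _ ?_
        exact tendsto_natCast_atTop_atTop.const_mul_atTop (sub_pos.2 hu)
    have := le_of_tendsto' ht hall
    rw [setLIntegral_const, ENNReal.top_mul h0.ne'] at this
    exact hC (top_le_iff.1 this)

/-- The bounded case mirrors `exists_lt_q`. The unbounded case does not: the mass at or below θ₀ may
be an atom at θ₀ and need not blow up, so instead the mass above θ₀ is sent to zero while the other
stays at least its value at y₀. -/
theorem exists_q_lt [SFinite ν] [SFinite μ] [NeZero μ] {θ₀ : ℝ} (h0 : 0 < μ (Ioi θ₀))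
    (h1 : 0 < μ (Iic θ₀))
    {n : ℕ} (ho : IsOpen (finiteSet ν μ n)) (hne : (finiteSet ν μ n).Nonempty)
    {p : ℝ} (hp : 0 < p) : ∃ y ∈ finiteSet ν μ n, q ν μ θ₀ n y < p := by
  by_contra! hcon
  obtain ⟨y₀, hy₀⟩ := hne
  have hf₀ := (mem_finiteSet_iff_cmass θ₀ n y₀).1 hy₀
  have hbd : ∀ y ∈ finiteSet ν μ n, p * (cmass ν μ θ₀ n (Iic θ₀) y).toReal ≤
      (cmass ν μ θ₀ n (Ioi θ₀) y).toReal := by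
    intro y hy
    have hf := (mem_finiteSet_iff_cmass θ₀ n y).1 hy
    have h := hcon y hy
    have h1 := ENNReal.toReal_pos (cmass_pos (ν := ν) h0 θ₀ n y).ne' hf.1
    have h3 : 0 ≤ (cmass ν μ θ₀ n (Iic θ₀) y).toReal := ENNReal.toReal_nonneg
    rw [q_eq θ₀ hy, le_div_iff₀ (by linarith)] at h
    nlinarith
  by_cases hb : BddBelow (finiteSet ν μ n)
  · obtain ⟨s, hs, hst, hsm⟩ := exists_seq_tendsto_sInf ⟨y₀, hy₀⟩ hb
    have hy : sInf (finiteSet ν μ n) ∉ finiteSet ν μ n := fun hmem => by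
      obtain ⟨z, hz1, hz2⟩ : (finiteSet ν μ n ∩ Iio (sInf (finiteSet ν μ n))).Nonempty :=
        Filter.nonempty_of_mem (f := nhdsWithin _ (Iio _))
          (Filter.inter_mem (nhdsWithin_le_nhds (ho.mem_nhds hmem)) self_mem_nhdsWithin)
      exact absurd (csInf_le hb hz1) (not_le.2 hz2)
    have hle₀ : sInf (finiteSet ν μ n) ≤ y₀ := csInf_le hb hy₀
    refine hy ((mem_finiteSet_iff_cmass θ₀ n _).2
      ⟨ne_top_of_le_ne_top hf₀.1 (cmass_mono_Ioi θ₀ n hle₀), ?_⟩)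
    have ht := tendsto_cmass (ν := ν) (μ := μ) θ₀ n (S := Iic θ₀) hst
      (by
        filter_upwards [ae_restrict_mem measurableSet_Iic] with u hu
        exact fun i j hij => cwt_le_cwt_of_le n hu (hs hij))
    have hC : ∀ y ∈ finiteSet ν μ n, y ≤ y₀ → cmass ν μ θ₀ n (Iic θ₀) y ≤
        ENNReal.ofReal ((cmass ν μ θ₀ n (Ioi θ₀) y₀).toReal / p) := by
      intro y hy hyle
      have hf := (mem_finiteSet_iff_cmass θ₀ n y).1 hy
      rw [← ENNReal.ofReal_toReal hf.2]
      refine ENNReal.ofReal_le_ofReal ?_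
      rw [le_div_iff₀ hp, mul_comm]
      exact (hbd y hy).trans (ENNReal.toReal_mono hf₀.1 (cmass_mono_Ioi θ₀ n hyle))
    refine ne_top_of_le_ne_top (b := ENNReal.ofReal ((cmass ν μ θ₀ n (Ioi θ₀) y₀).toReal / p))
      ENNReal.ofReal_ne_top (le_of_tendsto' ht fun k => ?_)
    rcases le_total (s k) y₀ with h | h
    · exact hC _ (hsm k) h
    · exact (cmass_anti_Iic θ₀ n h).trans (hC _ hy₀ le_rfl)
  · have hmem : ∀ y ≤ y₀, y ∈ finiteSet ν μ n := by
      intro y hy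
      rw [not_bddBelow_iff] at hb
      obtain ⟨z, hz, hzy⟩ := hb y
      exact (ordConnected_finiteSet n).out hz hy₀ ⟨hzy.le, hy⟩
    have ht : Filter.Tendsto (fun k : ℕ => cmass ν μ θ₀ n (Ioi θ₀) (y₀ - k)) Filter.atTop
        (nhds (∫⁻ _ in Ioi θ₀, 0 ∂μ)) := by
      refine lintegral_tendsto_of_tendsto_of_antitone
        (fun k => (measurable_cwt _ _ _).aemeasurable) ?_ (by
          simp only [Nat.cast_zero, sub_zero]
          exact hf₀.1) ?_
      · filter_upwards [ae_restrict_mem measurableSet_Ioi] with u hu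
        refine fun i j hij => cwt_le_cwt_of_gt n (le_of_lt hu) ?_
        have : (i : ℝ) ≤ j := by exact_mod_cast hij
        linarith
      · filter_upwards [ae_restrict_mem measurableSet_Ioi] with u hu
        rw [← ENNReal.ofReal_zero]
        refine (ENNReal.continuous_ofReal.tendsto 0).comp (Real.tendsto_exp_atBot.comp ?_)
        refine Filter.tendsto_atBot_add_const_right _ _ ?_
        refine Filter.Tendsto.const_mul_atBot (sub_pos.2 hu) ?_
        exact Filter.tendsto_atBot_add_const_left _ _
          (Filter.tendsto_neg_atTop_atBot.comp tendsto_natCast_atTop_atTop)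
    rw [lintegral_zero] at ht
    have ht' := (ENNReal.tendsto_toReal ENNReal.zero_ne_top).comp ht
    have hlow : ∀ k : ℕ, p * (cmass ν μ θ₀ n (Iic θ₀) y₀).toReal ≤
        (cmass ν μ θ₀ n (Ioi θ₀) (y₀ - k)).toReal := by
      intro k
      have hk : y₀ - k ≤ y₀ := by simp
      have hfk := (mem_finiteSet_iff_cmass θ₀ n _).1 (hmem _ hk)
      exact (mul_le_mul_of_nonneg_left (ENNReal.toReal_mono hfk.2 (cmass_anti_Iic θ₀ n hk))
        hp.le).trans (hbd _ (hmem _ hk))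
    have := ge_of_tendsto' ht' hlow
    have hpos := ENNReal.toReal_pos (cmass_pos (ν := ν) h1 θ₀ n y₀).ne' hf₀.2
    simp only [ENNReal.toReal_zero] at this
    nlinarith

theorem exists_q_eq [SFinite ν] [SFinite μ] [NeZero μ] {θ₀ : ℝ} (h0 : 0 < μ (Ioi θ₀))
    (h1 : 0 < μ (Iic θ₀)) {n : ℕ} (ho : IsOpen (finiteSet ν μ n))
    (hne : (finiteSet ν μ n).Nonempty) {p : ℝ} (hp : p ∈ Ioo (0 : ℝ) 1) :
    ∃ y, q ν μ θ₀ n y = p := by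
  obtain ⟨a, ha, hap⟩ := exists_q_lt (ν := ν) h0 h1 ho hne hp.1
  obtain ⟨b, hb, hbp⟩ := exists_lt_q (ν := ν) h0 ho hne hp.2
  have hc := continuousOn_q (ν := ν) h0 n
  rw [ho.interior_eq] at hc
  obtain ⟨y, -, hy⟩ := (ordConnected_finiteSet n).isPreconnected.intermediate_value ha hb hc
    ⟨hap.le, hbp.le⟩
  exact ⟨y, hy⟩

theorem nonempty_finiteSet (hν : ν ≠ 0) [SFinite ν] [IsProbabilityMeasure μ]
    (hμ : ∀ᵐ u ∂μ, u ∈ paramSet ν) (n : ℕ) : (finiteSet ν μ n).Nonempty := by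
  induction n with
  | zero => exact ⟨0, by simp [finiteSet]⟩
  | succ n ih =>
    obtain ⟨y, hy⟩ := ih
    have : NeZero ν := ⟨hν⟩
    obtain ⟨x, hx⟩ := (ae_add_mem_finiteSet hν hμ hy).exists
    exact ⟨y + x, hx⟩

/-- Two points of Y_n around y are both carried into Y_{n+1} by almost every x, and so is the
interval between them. Thus later stages can be handled on interiors, without openness of Y_{n+1}.
-/
theorem ae_add_mem_interior (hν : ν ≠ 0) [SFinite ν] [SFinite μ] [NeZero μ]
    (hμ : ∀ᵐ u ∂μ, u ∈ paramSet ν) {n : ℕ} {y : ℝ} (hy : y ∈ interior (finiteSet ν μ n)) :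
    ∀ᵐ x ∂ν, y + x ∈ interior (finiteSet ν μ (n + 1)) := by
  obtain ⟨a, b, hab, hsub⟩ := (mem_nhds_iff_exists_Ioo_subset).1 (mem_interior_iff_mem_nhds.1 hy)
  obtain ⟨a', ha'⟩ := exists_between hab.1
  obtain ⟨b', hb'⟩ := exists_between hab.2
  filter_upwards [ae_add_mem_finiteSet hν hμ (hsub ⟨ha'.1, ha'.2.trans hab.2⟩),
    ae_add_mem_finiteSet hν hμ (hsub ⟨hab.1.trans hb'.1, hb'.2⟩)] with x hx hx'
  rw [mem_interior_iff_mem_nhds]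
  refine Filter.mem_of_superset (Icc_mem_nhds (a := a' + x) (b := b' + x) ?_ ?_)
    ((ordConnected_finiteSet _).out hx hx')
  · linarith [ha'.2]
  · linarith [hb'.1]

end LevelCurves

/-! ### Concave analysis: supergradients, a crossing inequality, Lipschitz envelopes. -/

section Analysis

theorem exists_supergradient {F : ℝ → ℝ} (hF : ConcaveOn ℝ univ F) {K : ℝ}
    (hK : ∀ p r, |F p - F r| ≤ K * |p - r|) :
    ∃ s : ℝ → ℝ, Antitone s ∧ (∀ p r, F r ≤ F p + s p * (r - p)) ∧ ∀ p, |s p| ≤ K := by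
  have hc : ConvexOn ℝ univ (-F) := hF.neg
  have hi : ∀ p : ℝ, p ∈ interior (univ : Set ℝ) := fun p => by simp
  have hs : ∀ p r, F r ≤ F p + -derivWithin (-F) (Ioi p) p * (r - p) := by
    intro p r
    rcases lt_trichotomy p r with h | rfl | h
    · have := hc.rightDeriv_le_slope_of_mem_interior (hi p) (mem_univ r) h
      rw [slope_def_field, le_div_iff₀ (by linarith)] at this
      simp only [Pi.neg_apply] at this
      linarith
    · simp
    · have := (hc.slope_le_leftDeriv_of_mem_interior (mem_univ r) (hi p) h).trans
        (hc.leftDeriv_le_rightDeriv_of_mem_interior (hi p))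
      rw [slope_def_field, div_le_iff₀ (by linarith)] at this
      simp only [Pi.neg_apply] at this
      linarith
  refine ⟨fun p => -derivWithin (-F) (Ioi p) p, ?_, hs, fun p => ?_⟩
  · intro p r h
    rcases h.eq_or_lt with rfl | h
    · rfl
    · have h1 := hs p r
      have h2 := hs r p
      by_contra! hcon
      nlinarith
  -- Unit steps to both sides turn the Lipschitz bound into a bound on the supergradient.
  · have h1 := hs p (p + 1)
    have h2 := hs p (p - 1)
    have h3 := abs_le.1 (hK p (p + 1))
    have h4 := abs_le.1 (hK p (p - 1))
    simp only [sub_add_cancel_left, abs_neg, abs_one, mul_one, sub_sub_cancel] at h3 h4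
    rw [add_sub_cancel_left, mul_one] at h1
    rw [sub_sub_cancel_left, mul_neg_one] at h2
    rw [abs_le]
    constructor <;> linarith [h3.1, h3.2, h4.1, h4.2]

theorem exists_nonpos_of_integral_eq_zero {α : Type*} [MeasurableSpace α] {m : Measure α}
    (hm : m ≠ 0) {φ : α → ℝ} {S : Set α} (hS : ∀ᵐ x ∂m, x ∈ S) (hφ : Integrable φ m)
    (h0 : ∫ x, φ x ∂m = 0) : ∃ x ∈ S, φ x ≤ 0 := by
  by_contra! hcon
  have hpos : ∀ᵐ x ∂m, 0 < φ x := hS.mono hcon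
  have hz := (integral_eq_zero_iff_of_nonneg_ae (hpos.mono fun _ h => h.le) hφ).1 h0
  have : ∀ᵐ x ∂m, False := by
    filter_upwards [hpos, hz] with x h1 h2
    exact h1.ne' h2
  simp only [Filter.eventually_false_iff_eq_bot, ae_eq_bot] at this
  exact hm this

/-- A function which is smaller where a signed density of total mass zero is positive than where it
is nonpositive has a nonpositive integral with respect to that density. -/
theorem integral_mul_nonpos_of_crossing {α : Type*} [MeasurableSpace α] {m : Measure α}
    {φ R : α → ℝ} {S : Set α} (hS : ∀ᵐ x ∂m, x ∈ S) (hφ : Integrable φ m)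
    (h0 : ∫ x, φ x ∂m = 0) (hR : AEStronglyMeasurable R m) {L : ℝ} (hL : ∀ x, |R x| ≤ L)
    (h : ∀ x ∈ S, ∀ x' ∈ S, 0 < φ x → φ x' ≤ 0 → R x ≤ R x') :
    ∫ x, R x * φ x ∂m ≤ 0 := by
  by_cases hm : m = 0
  · simp [hm]
  obtain ⟨x₀, hx₀, hφ₀⟩ := exists_nonpos_of_integral_eq_zero hm hS hφ h0
  have hRφ : Integrable (fun x => R x * φ x) m :=
    hφ.bdd_mul (c := L) hR (Filter.Eventually.of_forall hL)
  -- The level r separates the values of R on the two sign sets of φ, so (R - r) φ ≤ 0 almost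
  -- everywhere, and r φ integrates to zero.
  set r := sInf (R '' {x | x ∈ S ∧ φ x ≤ 0}) with hr
  have hbd : BddBelow (R '' {x | x ∈ S ∧ φ x ≤ 0}) :=
    ⟨-L, by rintro _ ⟨x, -, rfl⟩; exact (abs_le.1 (hL x)).1⟩
  have hle : ∫ x, (R x * φ x - r * φ x) ∂m ≤ 0 := by
    refine integral_nonpos_of_ae ?_
    filter_upwards [hS] with x hx
    rcases le_or_gt (φ x) 0 with hφx | hφx
    · have : r ≤ R x := csInf_le hbd ⟨x, ⟨hx, hφx⟩, rfl⟩
      simp only [Pi.zero_apply]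
      nlinarith
    · have : R x ≤ r := le_csInf ⟨_, x₀, ⟨hx₀, hφ₀⟩, rfl⟩ (by
        rintro _ ⟨x', ⟨hx', hφx'⟩, rfl⟩
        exact h x hx x' hx' hφx hφx')
      simp only [Pi.zero_apply]
      nlinarith
  rw [integral_sub hRφ (hφ.const_mul r), integral_const_mul, h0] at hle
  linarith

variable {ι : Type*} {f g : ι → ℝ}

/-- The `K`-Lipschitz concave envelope of the values `g` at the points `f`. -/
noncomputable def lipEnvelope (f g : ι → ℝ) (K p : ℝ) : ℝ := ⨆ i, (g i - K * |p - f i|)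

theorem bddAbove_lipEnvelope (hg : ∀ i, g i ≤ 1) {K : ℝ} (hK : 0 ≤ K) (p : ℝ) :
    BddAbove (range fun i => g i - K * |p - f i|) :=
  ⟨1, by rintro _ ⟨i, rfl⟩; have := hg i; have := mul_nonneg hK (abs_nonneg (p - f i)); linarith⟩

theorem lipEnvelope_lipschitz [Nonempty ι] (hg : ∀ i, g i ≤ 1) {K : ℝ} (hK : 0 ≤ K) (p r : ℝ) :
    |lipEnvelope f g K p - lipEnvelope f g K r| ≤ K * |p - r| := by
  have key : ∀ p r, lipEnvelope f g K p ≤ lipEnvelope f g K r + K * |p - r| := by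
    intro p r
    refine ciSup_le fun i => ?_
    have h1 := le_ciSup (bddAbove_lipEnvelope (f := f) hg hK r) i
    have h2 : |r - f i| ≤ |p - f i| + |p - r| := by
      rw [abs_sub_comm p r]
      have := abs_sub_le r p (f i)
      linarith
    have h3 := mul_le_mul_of_nonneg_left h2 hK
    change g i - K * |r - f i| ≤ lipEnvelope f g K r at h1
    linarith
  have h1 := key p r
  have h2 := key r p
  rw [abs_sub_comm r p] at h2
  rw [abs_le]
  constructor <;> linarith

/-- Mixing near-optimal indices for p and r gives an index that is nearly good enough for the mixed
point, by convexity of the absolute value. -/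
theorem concaveOn_lipEnvelope [Nonempty ι] (hg : ∀ i, g i ≤ 1) {K : ℝ} (hK : 0 ≤ K)
    (hmix : ∀ i j a b, 0 ≤ a → 0 ≤ b → a + b = 1 →
      ∃ k, f k = a * f i + b * f j ∧ a * g i + b * g j ≤ g k) :
    ConcaveOn ℝ univ (lipEnvelope f g K) := by
  refine ⟨convex_univ, fun p _ r _ a b ha hb hab => ?_⟩
  simp only [smul_eq_mul]
  refine le_of_forall_pos_le_add fun ε hε => ?_
  obtain ⟨i, hi⟩ := exists_lt_of_lt_ciSup (sub_lt_self (lipEnvelope f g K p) hε)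
  obtain ⟨j, hj⟩ := exists_lt_of_lt_ciSup (sub_lt_self (lipEnvelope f g K r) hε)
  obtain ⟨k, hk, hgk⟩ := hmix i j a b ha hb hab
  have h1 := le_ciSup (bddAbove_lipEnvelope (f := f) hg hK (a * p + b * r)) k
  change g k - K * |a * p + b * r - f k| ≤ lipEnvelope f g K (a * p + b * r) at h1
  have h2 : |a * p + b * r - f k| ≤ a * |p - f i| + b * |r - f j| := by
    have : a * p + b * r - f k = a * (p - f i) + b * (r - f j) := by rw [hk]; ring
    rw [this]
    refine (abs_add_le _ _).trans ?_
    rw [abs_mul, abs_mul, abs_of_nonneg ha, abs_of_nonneg hb]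
  have h3 := mul_le_mul_of_nonneg_left h2 hK
  have h4 := mul_le_mul_of_nonneg_left hi.le ha
  have h5 := mul_le_mul_of_nonneg_left hj.le hb
  have h6 : a * ε + b * ε = ε := by rw [← add_mul, hab, one_mul]
  nlinarith

theorem le_lipEnvelope (hg : ∀ i, g i ≤ 1) {K : ℝ} (hK : 0 ≤ K) (i : ι) :
    g i ≤ lipEnvelope f g K (f i) := by
  have h1 := le_ciSup (bddAbove_lipEnvelope (f := f) hg hK (f i)) i
  simpa [lipEnvelope] using h1

theorem lipEnvelope_le_one [Nonempty ι] (hg : ∀ i, g i ≤ 1) {K : ℝ} (hK : 0 ≤ K) (p : ℝ) :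
    lipEnvelope f g K p ≤ 1 :=
  ciSup_le fun i => by
    have := hg i
    have := mul_nonneg hK (abs_nonneg (p - f i))
    linarith

theorem lipEnvelope_eq [Nonempty ι] (hg : ∀ i, g i ≤ 1) {K : ℝ} (hK : 0 ≤ K) {i : ι}
    (h : ∀ j, g j ≤ g i + K * |f j - f i|) : lipEnvelope f g K (f i) = g i := by
  refine le_antisymm (ciSup_le fun j => ?_) (le_lipEnvelope hg hK i)
  have := h j
  rw [abs_sub_comm] at this
  linarith

/-- A bounded mid-concave family has finite slopes at a point with values on both sides. -/
theorem exists_slope_bound (hg0 : ∀ i, 0 ≤ g i) (hg : ∀ i, g i ≤ 1)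
    (hconc : ∀ k i j a b, 0 ≤ a → 0 ≤ b → a + b = 1 → f k = a * f i + b * f j →
      a * g i + b * g j ≤ g k)
    {i l r : ι} (hl : f l < f i) (hr : f i < f r) :
    ∃ K, 0 ≤ K ∧ ∀ j, g j ≤ g i + K * |f j - f i| := by
  -- Values lie in [0, 1], so the chords from l and from r to i have slopes at most the reciprocal
  -- distances; the sum covers both sides.
  refine ⟨1 / (f i - f l) + 1 / (f r - f i),
    by have := sub_pos.2 hl; have := sub_pos.2 hr; positivity, fun j => ?_⟩
  have hl' := sub_pos.2 hl
  have hr' := sub_pos.2 hr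
  -- The hypothesis says that i lies strictly between m and j, so concavity bounds `g j` by
  -- extending the chord from m through i.
  have key : ∀ m, 0 < (f i - f m) * (f j - f i) →
      g j ≤ g i + |f j - f i| / |f i - f m| := by
    intro m hm
    have hA : 0 < |f i - f m| := abs_pos.2 fun h => by simp [h] at hm
    have hB : 0 < |f j - f i| := abs_pos.2 fun h => by simp [h] at hm
    have hmul : (f i - f m) * |f j - f i| = (f j - f i) * |f i - f m| := by
      rcases (mul_pos_iff.1 hm) with ⟨h1, h2⟩ | ⟨h1, h2⟩
      · rw [abs_of_pos h1, abs_of_pos h2]; ring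
      · rw [abs_of_neg h1, abs_of_neg h2]; ring
    have h := hconc i m j (|f j - f i| / (|f i - f m| + |f j - f i|))
      (|f i - f m| / (|f i - f m| + |f j - f i|)) (by positivity) (by positivity)
      (by field_simp; ring) (by field_simp; linarith)
    have h' : |f j - f i| * g m + |f i - f m| * g j ≤ g i * (|f i - f m| + |f j - f i|) := by
      have := mul_le_mul_of_nonneg_right h (add_pos hA hB).le
      field_simp at this
      linarith
    have hm0 := hg0 m
    have hi1 := hg i
    have : g j ≤ g i + g i * (|f j - f i| / |f i - f m|) := by
      rw [← sub_nonneg]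
      have : g i + g i * (|f j - f i| / |f i - f m|) - g j =
        (g i * (|f i - f m| + |f j - f i|) - |f i - f m| * g j) / |f i - f m| := by
        field_simp
      rw [this]
      refine div_nonneg ?_ hA.le
      nlinarith
    have h2 : 0 ≤ |f j - f i| / |f i - f m| := by positivity
    nlinarith
  rcases lt_trichotomy (f j) (f i) with hj | hj | hj
  · have := key r (by nlinarith)
    rw [abs_sub_comm (f i) (f r), abs_of_pos hr'] at this
    have h2 : 0 ≤ 1 / (f i - f l) * |f j - f i| := by positivity
    rw [add_mul]
    have h3 : |f j - f i| / (f r - f i) = 1 / (f r - f i) * |f j - f i| := by ring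
    linarith
  · have := hconc i j j 1 0 zero_le_one le_rfl (by norm_num) (by rw [hj]; ring)
    simp [hj]
    linarith
  · have := key l (by nlinarith)
    rw [abs_of_pos hl'] at this
    have h2 : 0 ≤ 1 / (f r - f i) * |f j - f i| := by positivity
    rw [add_mul]
    have h3 : |f j - f i| / (f i - f l) = 1 / (f i - f l) * |f j - f i| := by ring
    linarith

end Analysis

/-! ### Monotone likelihood ratios and the spreading of posteriors. -/

section OneStep

variable {ν μ : Measure ℝ}

theorem integrable_of_abs_le {α : Type*} [MeasurableSpace α] {m : Measure α} [IsFiniteMeasure m]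
    {f : α → ℝ} (hf : Measurable f) {L : ℝ} (hL : ∀ x, |f x| ≤ L) : Integrable f m :=
  Integrable.of_bound hf.aestronglyMeasurable L (Filter.Eventually.of_forall hL)

theorem abs_integral_le_of_abs_le {α : Type*} [MeasurableSpace α] {m : Measure α}
    [IsProbabilityMeasure m] {f : α → ℝ} {L : ℝ} (hL : ∀ x, |f x| ≤ L) : |∫ x, f x ∂m| ≤ L := by
  have := norm_integral_le_of_norm_le_const (μ := m) (f := f) (C := L)
    (Filter.Eventually.of_forall hL)
  simpa using this

theorem integral_mix {α : Type*} [MeasurableSpace α] {m : Measure α} {f g h : α → ℝ}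
    (hf : Integrable f m) (hg : Integrable g m) (hh : Integrable h m) (a b : ℝ) :
    ∫ x, (a * f x + b * g x - h x) ∂m = a * ∫ x, f x ∂m + b * ∫ x, g x ∂m - ∫ x, h x ∂m := by
  rw [integral_sub (f := fun x => a * f x + b * g x) ((hf.const_mul a).add (hg.const_mul b)) hh,
    integral_add (hf.const_mul a) (hg.const_mul b), integral_const_mul, integral_const_mul]

theorem postDens_nonneg (n : ℕ) (y u : ℝ) : 0 ≤ postDens ν μ n y u :=
  div_nonneg (Real.exp_pos _).le ENNReal.toReal_nonneg

theorem integrable_postDens {n : ℕ} {y : ℝ} (hy : y ∈ finiteSet ν μ n) :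
    Integrable (postDens ν μ n y) μ :=
  Integrable.div_const hy _

theorem integral_posterior [SFinite ν] [SFinite μ] (n : ℕ) (y : ℝ) (R : ℝ → ℝ) :
    ∫ u, R u ∂posterior ν μ n y = ∫ u, R u * postDens ν μ n y u ∂μ := by
  rw [posterior_eq, integral_withDensity_eq_integral_toReal_smul
    (measurable_postDens_right n y).ennreal_ofReal (by simp)]
  refine integral_congr_ae (Filter.Eventually.of_forall fun u => ?_)
  simp only [ENNReal.toReal_ofReal (postDens_nonneg n y u), smul_eq_mul]
  ring

theorem setIntegral_postDens [SFinite ν] [SFinite μ] (n : ℕ) (y : ℝ) {S : Set ℝ}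
    (hS : MeasurableSet S) :
    ∫ u in S, postDens ν μ n y u ∂μ = (posterior ν μ n y).real S := by
  have h := integral_posterior (ν := ν) (μ := μ) n y (S.indicator 1)
  rw [integral_indicator_one hS] at h
  rw [h, ← integral_indicator hS]
  refine integral_congr_ae (Filter.Eventually.of_forall fun u => ?_)
  by_cases hu : u ∈ S <;> simp [hu]

theorem integral_obsLaw (hν : ν ≠ 0) [SFinite ν] {u : ℝ} (hu : u ∈ paramSet ν) (A : ℝ → ℝ) :
    ∫ x, A x ∂obsLaw ν u = ∫ x, A x * dens ν u x ∂ν := by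
  have hm : Measurable fun x => ENNReal.ofReal (dens ν u x) :=
    (measurable_dens ν).comp (measurable_const.prodMk measurable_id)
  rw [obsLaw_eq hν hu, integral_withDensity_eq_integral_toReal_smul hm (by simp)]
  refine integral_congr_ae (Filter.Eventually.of_forall fun x => ?_)
  simp only [dens, ENNReal.toReal_ofReal (Real.exp_pos _).le, smul_eq_mul]
  ring

theorem integrable_dens {u : ℝ} (hu : u ∈ paramSet ν) : Integrable (dens ν u) ν := by
  have hu' : Integrable (fun x => Real.exp (u * x)) ν := hu
  refine (hu'.mul_const (Real.exp (-B ν u))).congr (Filter.Eventually.of_forall fun x => ?_)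
  simp only [dens, ← Real.exp_add, sub_eq_add_neg]

/-- The family of observation laws is stochastically increasing in the parameter. -/
theorem integral_obsLaw_mono (hν : ν ≠ 0) [SFinite ν] {u u' : ℝ} (hu : u ∈ paramSet ν)
    (hu' : u' ∈ paramSet ν) (h : u ≤ u') {A : ℝ → ℝ} (hA : Measurable A) {L : ℝ}
    (hL : ∀ x, |A x| ≤ L) {S : Set ℝ} (hS : ∀ᵐ x ∂ν, x ∈ S) (hmono : MonotoneOn A S) :
    ∫ x, A x ∂obsLaw ν u ≤ ∫ x, A x ∂obsLaw ν u' := by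
  have hi := integrable_dens hu
  have hi' := integrable_dens hu'
  have hone : ∀ v ∈ paramSet ν, ∫ x, dens ν v x ∂ν = 1 := fun v hv => by
    have := integral_obsLaw hν hv fun _ => 1
    simpa using this.symm
  have key := integral_mul_nonpos_of_crossing (m := ν) (φ := fun x => dens ν u x - dens ν u' x)
    (R := A) hS (hi.sub hi') (by rw [integral_sub hi hi', hone u hu, hone u' hu', sub_self])
    hA.aestronglyMeasurable hL (by
      intro x hx x' hx' h1 h2
      refine hmono hx hx' ?_
      -- Monotone likelihood ratio: the log-ratio of the densities is affine in x with slope u - u'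
      -- ≤ 0, so the set where the density at u is larger lies to the left.
      by_contra! hlt
      have h1' : u' * x - B ν u' < u * x - B ν u := Real.exp_lt_exp.1 (sub_pos.1 h1)
      have h2' : u * x' - B ν u ≤ u' * x' - B ν u' := Real.exp_le_exp.1 (sub_nonpos.1 h2)
      nlinarith)
  have hb : ∀ v ∈ paramSet ν, Integrable (fun x => A x * dens ν v x) ν := fun v hv =>
    (integrable_dens hv).bdd_mul hA.aestronglyMeasurable (Filter.Eventually.of_forall hL)
  simp only [mul_sub] at key
  rw [integral_sub (hb u hu) (hb u' hu')] at key
  rw [integral_obsLaw hν hu, integral_obsLaw hν hu']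
  linarith

/-- By Bayes' formula `q (n+1) (y+x)` is the conditional probability of Θ > θ₀ given x, so under the
joint law it may be replaced by the indicator. -/
theorem integral_joint_q_of_nonneg (hν : ν ≠ 0) [SFinite ν] [SFinite μ] [NeZero μ]
    (hμ : ∀ᵐ u ∂μ, u ∈ paramSet ν) (θ₀ : ℝ) {n : ℕ} {y : ℝ} (hy : y ∈ finiteSet ν μ n)
    {D : ℝ → ℝ} (hD : Measurable D) (h0 : ∀ x, 0 ≤ D x) :
    ∫ z, q ν μ θ₀ (n + 1) (y + z.2) * D z.2 ∂joint ν μ n y =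
      ∫ z, (Ioi θ₀).indicator 1 z.1 * D z.2 ∂joint ν μ n y := by
  have hq := measurable_q (ν := ν) (μ := μ) θ₀ (n + 1)
  have hi : Measurable ((Ioi θ₀).indicator (1 : ℝ → ℝ)) :=
    measurable_one.indicator measurableSet_Ioi
  have hi0 : ∀ u, 0 ≤ (Ioi θ₀).indicator (1 : ℝ → ℝ) u :=
    fun u => indicator_nonneg (fun _ _ => zero_le_one) u
  rw [integral_eq_lintegral_of_nonneg_ae
      (Filter.Eventually.of_forall fun z => mul_nonneg (q_nonneg _ _ _) (h0 _))
      (by fun_prop : Measurable _).aestronglyMeasurable,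
    integral_eq_lintegral_of_nonneg_ae
      (Filter.Eventually.of_forall fun z => mul_nonneg (hi0 _) (h0 _))
      (by fun_prop : Measurable _).aestronglyMeasurable,
    lintegral_joint_posterior hν hμ hy
      (G := fun z => ENNReal.ofReal ((Ioi θ₀).indicator 1 z.1 * D z.2)) (by fun_prop)]
  congr 1
  refine lintegral_congr fun z => ?_
  simp only [ENNReal.ofReal_mul (hi0 _), ENNReal.ofReal_mul (q_nonneg _ _ _)]
  rw [lintegral_mul_const _ (by fun_prop)]
  congr 1
  rw [q, ofReal_measureReal, ← lintegral_indicator_one measurableSet_Ioi]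
  refine lintegral_congr fun u => ?_
  by_cases hu : u ∈ Ioi θ₀ <;> simp [hu]

theorem integral_joint_q (hν : ν ≠ 0) [SFinite ν] [SFinite μ] [NeZero μ]
    (hμ : ∀ᵐ u ∂μ, u ∈ paramSet ν) (θ₀ : ℝ) {n : ℕ} {y : ℝ} (hy : y ∈ finiteSet ν μ n)
    {D : ℝ → ℝ} (hD : Measurable D) {L : ℝ} (hL : ∀ x, |D x| ≤ L) :
    ∫ z, q ν μ θ₀ (n + 1) (y + z.2) * D z.2 ∂joint ν μ n y =
      ∫ z, (Ioi θ₀).indicator 1 z.1 * D z.2 ∂joint ν μ n y := by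
  have hq := measurable_q (ν := ν) (μ := μ) θ₀ (n + 1)
  have hi : Measurable ((Ioi θ₀).indicator (1 : ℝ → ℝ)) :=
    measurable_one.indicator measurableSet_Ioi
  have hi1 : ∀ u, |(Ioi θ₀).indicator (1 : ℝ → ℝ) u| ≤ 1 := fun u => by
    by_cases hu : u ∈ Ioi θ₀ <;> simp [hu]
  have hq1 : ∀ y, |q ν μ θ₀ (n + 1) y| ≤ 1 := fun y => by
    rw [abs_of_nonneg (q_nonneg _ _ _)]
    exact q_le_one _ _ _
  -- Shifting by the bound L makes the integrand nonnegative; the constant part is then subtracted.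
  have h1 := integral_joint_q_of_nonneg hν hμ θ₀ hy (D := fun x => D x + L) (by fun_prop)
    fun x => by linarith [(abs_le.1 (hL x)).1]
  have h2 := integral_joint_q_of_nonneg hν hμ θ₀ hy (D := fun _ => L) (by fun_prop)
    fun x => (abs_nonneg _).trans (hL x)
  have hint : ∀ {w : ℝ × ℝ → ℝ}, Measurable w → (∀ z, |w z| ≤ 1) →
      ∫ z, w z * (D z.2 + L) ∂joint ν μ n y =
        ∫ z, w z * D z.2 ∂joint ν μ n y + ∫ z, w z * L ∂joint ν μ n y := by
    intro w hw hw1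
    simp only [mul_add]
    refine integral_add (integrable_of_abs_le (by fun_prop) (L := L) fun z => ?_)
      (integrable_of_abs_le (by fun_prop) (L := |L|) fun z => ?_)
    · rw [abs_mul]
      exact (mul_le_of_le_one_left (abs_nonneg _) (hw1 z)).trans (hL _)
    · rw [abs_mul]
      exact mul_le_of_le_one_left (abs_nonneg _) (hw1 z)
  rw [hint (by fun_prop) fun z => hq1 _, hint (by fun_prop) fun z => hi1 _] at h1
  linarith

theorem convexOn_exp_mix (a b s t : ℝ) (ha : 0 ≤ a) (hb : 0 ≤ b) :
    ConvexOn ℝ univ fun u : ℝ => a * Real.exp (u * s) + b * Real.exp (u * t) := by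
  have h : ∀ s : ℝ, ConvexOn ℝ univ fun u : ℝ => Real.exp (u * s) := fun s =>
    convexOn_exp.comp_linearMap (LinearMap.mulRight ℝ s)
  exact ((h s).smul ha).add ((h t).smul hb)

/-- The set where a mixture of two posterior densities is below a third one is an interval. -/
theorem ordConnected_postDens_mix [SFinite ν] [NeZero μ] {n : ℕ} {y₀ y₁ y₂ : ℝ}
    (h0 : y₀ ∈ finiteSet ν μ n) {a b : ℝ} (ha : 0 ≤ a) (hb : 0 ≤ b) :
    OrdConnected {u | a * postDens ν μ n y₁ u + b * postDens ν μ n y₂ u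
      - postDens ν μ n y₀ u ≤ 0} := by
  have hZ := ENNReal.toReal_pos (mass_ne_zero (ν := ν) n y₀) ((mem_finiteSet_iff n y₀).1 h0)
  -- Dividing by the density at y₀ cancels B(u), leaving a nonnegative combination of exponentials
  -- in u; the set in question is its sublevel set at 1.
  have hc := convexOn_exp_mix (a * (mass ν μ n y₀).toReal / (mass ν μ n y₁).toReal)
    (b * (mass ν μ n y₀).toReal / (mass ν μ n y₂).toReal) (y₁ - y₀) (y₂ - y₀)
    (by positivity) (by positivity)
  have := (hc.convex_le 1).ordConnected
  suffices hiff : ∀ u, a * postDens ν μ n y₁ u + b * postDens ν μ n y₂ u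
      - postDens ν μ n y₀ u ≤ 0 ↔ a * (mass ν μ n y₀).toReal / (mass ν μ n y₁).toReal *
        Real.exp (u * (y₁ - y₀)) + b * (mass ν μ n y₀).toReal / (mass ν μ n y₂).toReal *
        Real.exp (u * (y₂ - y₀)) ≤ 1 from
    ⟨fun u hu v hv w hw =>
      (hiff w).2 (this.out ⟨mem_univ u, (hiff u).1 hu⟩ ⟨mem_univ v, (hiff v).1 hv⟩ hw).2⟩
  intro u
  have e : ∀ y, Real.exp (u * (y - y₀)) =
      Real.exp (u * y - n * B ν u) / Real.exp (u * y₀ - n * B ν u) := fun y => by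
    rw [← Real.exp_sub]; congr 1; ring
  have hE := Real.exp_pos (u * y₀ - n * B ν u)
  rw [e, e, sub_nonpos, ← mul_le_mul_iff_left₀ (a := (mass ν μ n y₀).toReal /
    Real.exp (u * y₀ - n * B ν u)) (by positivity)]
  unfold postDens
  have : Real.exp (u * y₀ - n * B ν u) / (mass ν μ n y₀).toReal *
    ((mass ν μ n y₀).toReal / Real.exp (u * y₀ - n * B ν u)) = 1 := by field_simp
  rw [this]
  refine iff_of_eq (congrArg (· ≤ (1 : ℝ)) ?_)
  ring

/-- Spreading out the posterior distribution lowers the integral of a function which is increasing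
below `θ₀` and decreasing above `θ₀`. -/
theorem integral_posterior_mix_le [SFinite ν] [SFinite μ] [NeZero μ] {θ₀ : ℝ}
    (hθ : μ (Ioi θ₀) ≠ 0) (hθ' : μ (Iic θ₀) ≠ 0) {N : Set ℝ} (hN : ∀ᵐ u ∂μ, u ∈ N)
    {n : ℕ} {y₀ y₁ y₂ : ℝ} (h0 : y₀ ∈ finiteSet ν μ n) (h1 : y₁ ∈ finiteSet ν μ n)
    (h2 : y₂ ∈ finiteSet ν μ n) {a b : ℝ} (ha : 0 ≤ a) (hb : 0 ≤ b) (hab : a + b = 1)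
    (hq : q ν μ θ₀ n y₀ = a * q ν μ θ₀ n y₁ + b * q ν μ θ₀ n y₂)
    {R : ℝ → ℝ} (hR : Measurable R) {L : ℝ} (hL : ∀ u, |R u| ≤ L)
    (hmono : MonotoneOn R (Iic θ₀ ∩ N)) (hanti : AntitoneOn R (Ioi θ₀ ∩ N)) :
    a * ∫ u, R u ∂posterior ν μ n y₁ + b * ∫ u, R u ∂posterior ν μ n y₂ ≤
      ∫ u, R u ∂posterior ν μ n y₀ := by
  set φ : ℝ → ℝ := fun u => a * postDens ν μ n y₁ u + b * postDens ν μ n y₂ u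
      - postDens ν μ n y₀ u with hφ
  have i0 := integrable_postDens h0
  have i1 := integrable_postDens h1
  have i2 := integrable_postDens h2
  have hφi : Integrable φ μ := ((i1.const_mul a).add (i2.const_mul b)).sub i0
  have hφS : ∀ S, MeasurableSet S → ∫ u in S, φ u ∂μ = a * (posterior ν μ n y₁).real S +
      b * (posterior ν μ n y₂).real S - (posterior ν μ n y₀).real S := by
    intro S hS
    rw [hφ, integral_mix i1.integrableOn i2.integrableOn i0.integrableOn,
      setIntegral_postDens _ _ hS, setIntegral_postDens _ _ hS, setIntegral_postDens _ _ hS]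
  have hright : ∫ u in Ioi θ₀, φ u ∂μ = 0 := by
    rw [hφS _ measurableSet_Ioi]
    change a * q ν μ θ₀ n y₁ + b * q ν μ θ₀ n y₂ - q ν μ θ₀ n y₀ = 0
    rw [hq, sub_self]
  have hleft : ∫ u in Iic θ₀, φ u ∂μ = 0 := by
    have := isProb_posterior h0
    have := isProb_posterior h1
    have := isProb_posterior h2
    have hc : ∀ y, IsProbabilityMeasure (posterior ν μ n y) →
        (posterior ν μ n y).real (Iic θ₀) = 1 - q ν μ θ₀ n y := fun y _ => by
      rw [← compl_Ioi, probReal_compl_eq_one_sub measurableSet_Ioi, q]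
    rw [hφS _ measurableSet_Iic, hc _ ‹_›, hc _ ‹_›, hc _ ‹_›, hq]
    linear_combination hab
  have hS : ∀ S, MeasurableSet S → ∀ᵐ u ∂μ.restrict S, u ∈ S ∩ N := fun S hS => by
    filter_upwards [ae_restrict_mem hS, ae_restrict_of_ae hN] with u h h'
    exact ⟨h, h'⟩
  -- The interval where φ ≤ 0 contains some l ≤ θ₀ < r, so on each side of θ₀ the set where φ > 0
  -- lies farther from θ₀ than the set where φ ≤ 0.
  have hconn := ordConnected_postDens_mix (y₁ := y₁) (y₂ := y₂) h0 ha hb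
  obtain ⟨r, hr, hφr⟩ := exists_nonpos_of_integral_eq_zero
    (by simpa using hθ) (hS _ measurableSet_Ioi) hφi.integrableOn hright
  obtain ⟨l, hl, hφl⟩ := exists_nonpos_of_integral_eq_zero
    (by simpa using hθ') (hS _ measurableSet_Iic) hφi.integrableOn hleft
  have kright := integral_mul_nonpos_of_crossing (hS _ measurableSet_Ioi) hφi.integrableOn hright
    hR.aestronglyMeasurable hL (by
      intro u hu u' hu' hp hn
      refine hanti hu' hu ?_
      by_contra! hlt
      exact absurd (hconn.out hφl hn ⟨(show l ≤ θ₀ from hl.1).trans (le_of_lt hu.1), hlt.le⟩)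
        (not_le.2 hp))
  have kleft := integral_mul_nonpos_of_crossing (hS _ measurableSet_Iic) hφi.integrableOn hleft
    hR.aestronglyMeasurable hL (by
      intro u hu u' hu' hp hn
      refine hmono hu hu' ?_
      by_contra! hlt
      exact absurd (hconn.out hn hφr ⟨hlt.le, (show u ≤ θ₀ from hu.1).trans (le_of_lt hr.1)⟩)
        (not_le.2 hp))
  have hb' : ∀ {ψ : ℝ → ℝ}, Integrable ψ μ → Integrable (fun u => R u * ψ u) μ := fun hψ =>
    hψ.bdd_mul hR.aestronglyMeasurable (Filter.Eventually.of_forall hL)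
  have hsum : ∫ u, R u * φ u ∂μ ≤ 0 := by
    rw [← integral_add_compl measurableSet_Ioi (hb' hφi), compl_Ioi]
    linarith
  have hexp : ∫ u, R u * φ u ∂μ = a * ∫ u, R u * postDens ν μ n y₁ u ∂μ +
      b * ∫ u, R u * postDens ν μ n y₂ u ∂μ - ∫ u, R u * postDens ν μ n y₀ u ∂μ := by
    rw [← integral_mix (hb' i1) (hb' i2) (hb' i0)]
    refine integral_congr_ae (Filter.Eventually.of_forall fun u => ?_)
    simp only [hφ]
    ring
  rw [integral_posterior, integral_posterior, integral_posterior]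
  linarith

end OneStep

/-! ### The one-step expectation preserves concavity in `q`. -/

section ConcavityStep

variable {ν μ : Measure ℝ}

/-- Concavity of `h` as a function of the coordinate `q(n,y)` on the interior of `Y_n`. -/
def QConcave (ν μ : Measure ℝ) (θ₀ : ℝ) (n : ℕ) (h : ℝ → ℝ) : Prop :=
  ∀ ⦃y₀ y₁ y₂ : ℝ⦄, y₀ ∈ interior (finiteSet ν μ n) → y₁ ∈ interior (finiteSet ν μ n) →
    y₂ ∈ interior (finiteSet ν μ n) → ∀ ⦃a b : ℝ⦄, 0 ≤ a → 0 ≤ b → a + b = 1 →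
    q ν μ θ₀ n y₀ = a * q ν μ θ₀ n y₁ + b * q ν μ θ₀ n y₂ → a * h y₁ + b * h y₂ ≤ h y₀

theorem qconcave_comp {F : ℝ → ℝ} (hF : ConcaveOn ℝ univ F) (θ₀ : ℝ) (n : ℕ) :
    QConcave ν μ θ₀ n fun y => F (q ν μ θ₀ n y) := by
  intro y₀ y₁ y₂ _ _ _ a b ha hb hab hq
  simpa only [hq, smul_eq_mul] using hF.2 (mem_univ _) (mem_univ _) ha hb hab

theorem QConcave.min {θ₀ : ℝ} {n : ℕ} {h h' : ℝ → ℝ} (hh : QConcave ν μ θ₀ n h)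
    (hh' : QConcave ν μ θ₀ n h') : QConcave ν μ θ₀ n fun y => min (h y) (h' y) := by
  intro y₀ y₁ y₂ h0 h1 h2 a b ha hb hab hq
  refine le_min ((add_le_add ?_ ?_).trans (hh h0 h1 h2 ha hb hab hq))
    ((add_le_add ?_ ?_).trans (hh' h0 h1 h2 ha hb hab hq)) <;>
  first
  | exact mul_le_mul_of_nonneg_left (min_le_left _ _) (by assumption)
  | exact mul_le_mul_of_nonneg_left (min_le_right _ _) (by assumption)

theorem QConcave.const_add {θ₀ : ℝ} {n : ℕ} {h : ℝ → ℝ} (hh : QConcave ν μ θ₀ n h) (c : ℝ) :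
    QConcave ν μ θ₀ n fun y => c + h y := by
  intro y₀ y₁ y₂ h0 h1 h2 a b ha hb hab hq
  have := hh h0 h1 h2 ha hb hab hq
  have e : a * (c + h y₁) + b * (c + h y₂) = (a + b) * c + (a * h y₁ + b * h y₂) := by ring
  rw [e, hab]
  linarith

/-- The conditional expected cost given the parameter, for the cost `A(x)` if the parameter is at
most `θ₀` and `A(x) + D(x)` otherwise. -/
noncomputable def risk (ν : Measure ℝ) (θ₀ : ℝ) (A D : ℝ → ℝ) (u : ℝ) : ℝ :=
  ∫ x, (A x + (Ioi θ₀).indicator 1 u * D x) ∂obsLaw ν u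

theorem abs_add_indicator_mul_le {θ₀ : ℝ} {A D : ℝ → ℝ} {L K : ℝ} (hL : ∀ x, |A x| ≤ L)
    (hK : ∀ x, |D x| ≤ K) (u x : ℝ) : |A x + (Ioi θ₀).indicator 1 u * D x| ≤ L + K := by
  refine (abs_add_le _ _).trans (add_le_add (hL x) ?_)
  by_cases hu : u ∈ Ioi θ₀
  · simpa [hu] using hK x
  · simpa [hu] using (abs_nonneg _).trans (hK x)

theorem measurable_risk [SFinite ν] (θ₀ : ℝ) {A D : ℝ → ℝ} (hA : Measurable A)
    (hD : Measurable D) : Measurable (risk ν θ₀ A D) := by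
  have hi : Measurable ((Ioi θ₀).indicator (1 : ℝ → ℝ)) :=
    measurable_one.indicator measurableSet_Ioi
  have : Measurable fun z : ℝ × ℝ => A z.2 + (Ioi θ₀).indicator 1 z.1 * D z.2 := by fun_prop
  exact (this.stronglyMeasurable.integral_kernel_prod_right' (κ := obsKernel ν)).measurable

/-- This linearises the problem: the expected tangent value depends on the state only through the
posterior that integrates the fixed function `risk`. -/
theorem integral_risk_posterior (hν : ν ≠ 0) [SFinite ν] [SFinite μ] [NeZero μ]
    (hμ : ∀ᵐ u ∂μ, u ∈ paramSet ν) (θ₀ : ℝ) {n : ℕ} {y : ℝ} (hy : y ∈ finiteSet ν μ n)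
    {A D : ℝ → ℝ} (hA : Measurable A) (hD : Measurable D) {L K : ℝ} (hL : ∀ x, |A x| ≤ L)
    (hK : ∀ x, |D x| ≤ K) :
    ∫ z, (A z.2 + q ν μ θ₀ (n + 1) (y + z.2) * D z.2) ∂joint ν μ n y =
      ∫ u, risk ν θ₀ A D u ∂posterior ν μ n y := by
  have hi : Measurable ((Ioi θ₀).indicator (1 : ℝ → ℝ)) :=
    measurable_one.indicator measurableSet_Ioi
  have hq := measurable_q (ν := ν) (μ := μ) θ₀ (n + 1)
  have i1 : Integrable (fun z : ℝ × ℝ => A z.2) (joint ν μ n y) :=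
    integrable_of_abs_le (by fun_prop) fun z => hL z.2
  have i2 : Integrable (fun z : ℝ × ℝ => q ν μ θ₀ (n + 1) (y + z.2) * D z.2) (joint ν μ n y) :=
    integrable_of_abs_le (by fun_prop) (L := K) fun z => by
      rw [abs_mul, abs_of_nonneg (q_nonneg _ _ _)]
      exact (mul_le_of_le_one_left (abs_nonneg _) (q_le_one _ _ _)).trans (hK _)
  have i3 : Integrable (fun z : ℝ × ℝ => (Ioi θ₀).indicator 1 z.1 * D z.2) (joint ν μ n y) :=
    integrable_of_abs_le (by fun_prop) (L := K) fun z => by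
      by_cases hu : z.1 ∈ Ioi θ₀
      · simpa [hu] using hK z.2
      · simpa [hu] using (abs_nonneg _).trans (hK z.2)
  rw [integral_add i1 i2, integral_joint_q hν hμ θ₀ hy hD hK, ← integral_add i1 i3]
  exact Measure.integral_compProd (i1.add i3)

theorem risk_monotoneOn (hν : ν ≠ 0) [SFinite ν] (θ₀ : ℝ) {A D : ℝ → ℝ} (hA : Measurable A)
    {L : ℝ} (hL : ∀ x, |A x| ≤ L) {S : Set ℝ} (hS : ∀ᵐ x ∂ν, x ∈ S) (hmono : MonotoneOn A S) :
    MonotoneOn (risk ν θ₀ A D) (Iic θ₀ ∩ paramSet ν) := by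
  intro u hu u' hu' h
  have e : ∀ u ∈ Iic θ₀, risk ν θ₀ A D u = ∫ x, A x ∂obsLaw ν u := fun u hu => by
    have : u ∉ Ioi θ₀ := by simpa using hu
    simp [risk, this]
  rw [e u hu.1, e u' hu'.1]
  exact integral_obsLaw_mono hν hu.2 hu'.2 h hA hL hS hmono

theorem risk_antitoneOn (hν : ν ≠ 0) [SFinite ν] (θ₀ : ℝ) {A D : ℝ → ℝ} (hA : Measurable A)
    (hD : Measurable D) {L K : ℝ} (hL : ∀ x, |A x| ≤ L) (hK : ∀ x, |D x| ≤ K)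
    {S : Set ℝ} (hS : ∀ᵐ x ∂ν, x ∈ S) (hanti : AntitoneOn (fun x => A x + D x) S) :
    AntitoneOn (risk ν θ₀ A D) (Ioi θ₀ ∩ paramSet ν) := by
  intro u hu u' hu' h
  have e : ∀ u ∈ Ioi θ₀, risk ν θ₀ A D u = -∫ x, -(A x + D x) ∂obsLaw ν u := fun u hu => by
    rw [integral_neg, neg_neg]
    simp [risk, hu]
  rw [e u hu.1, e u' hu'.1]
  refine neg_le_neg (integral_obsLaw_mono hν hu.2 hu'.2 h (by fun_prop) (L := L + K)
    (fun x => ?_) hS fun x hx x' hx' hxx' => neg_le_neg (hanti hx hx' hxx'))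
  rw [abs_neg]
  exact (abs_add_le _ _).trans (add_le_add (hL x) (hK x))

/-- The heart of the proof. The tangent lines are taken along the continuation from y₀ and kept
fixed; they give an upper bound from y₁ and y₂, equality from y₀, and the posterior mixture
inequality compares the three. -/
theorem qconcave_integral_of_lipschitz (hν : ν ≠ 0) [SFinite ν] [SFinite μ] [NeZero μ]
    (hμ : ∀ᵐ u ∂μ, u ∈ paramSet ν) {θ₀ : ℝ} (hθ : 0 < μ (Ioi θ₀)) (hθ' : 0 < μ (Iic θ₀))
    {F : ℝ → ℝ} (hF : ConcaveOn ℝ univ F) {K : ℝ} (hK : ∀ p r, |F p - F r| ≤ K * |p - r|)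
    (n : ℕ) :
    QConcave ν μ θ₀ n fun y => ∫ z, F (q ν μ θ₀ (n + 1) (y + z.2)) ∂joint ν μ n y := by
  intro y₀ y₁ y₂ h0 h1 h2 a b ha hb hab hq
  replace h0 := interior_subset h0
  replace h1 := interior_subset h1
  replace h2 := interior_subset h2
  obtain ⟨s, hs, hsup, hsK⟩ := exists_supergradient hF hK
  have hK0 : 0 ≤ K := (abs_nonneg _).trans (hsK 0)
  have hFm : Measurable F := by
    have : LipschitzWith K.toNNReal F := LipschitzWith.of_dist_le_mul fun p r => by
      simpa [Real.dist_eq, hK0] using hK p r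
    exact this.continuous.measurable
  have hsm : Measurable s := hs.measurable
  have hqm := measurable_q (ν := ν) (μ := μ) θ₀ (n + 1)
  have hq0 := q_nonneg (ν := ν) (μ := μ) θ₀ (n + 1)
  have hq1 := q_le_one (ν := ν) (μ := μ) θ₀ (n + 1)
  set p : ℝ → ℝ := fun x => q ν μ θ₀ (n + 1) (y₀ + x) with hp
  have hpm : Measurable p := by fun_prop
  set A : ℝ → ℝ := fun x => F (p x) - s (p x) * p x with hAdef
  set D : ℝ → ℝ := fun x => s (p x) with hDdef
  have hA : Measurable A := by fun_prop
  have hD : Measurable D := by fun_prop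
  have hD1 : ∀ x, |D x| ≤ K := fun x => hsK _
  have hF1 : ∀ y, |F (q ν μ θ₀ (n + 1) y)| ≤ |F 0| + K := fun y => by
    have h := hK (q ν μ θ₀ (n + 1) y) 0
    have h' := abs_sub_abs_le_abs_sub (F (q ν μ θ₀ (n + 1) y)) (F 0)
    rw [sub_zero, abs_of_nonneg (hq0 y)] at h
    nlinarith [hq1 y]
  have hA1 : ∀ x, |A x| ≤ |F 0| + K + K := fun x => by
    refine (abs_sub _ _).trans (add_le_add (hF1 _) ?_)
    rw [abs_mul, abs_of_nonneg (hq0 _)]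
    exact (mul_le_of_le_one_right (abs_nonneg _) (hq1 _)).trans (hsK _)
  have hS := ae_add_mem_finiteSet hν hμ h0
  have hpS : ∀ x ∈ {x | y₀ + x ∈ finiteSet ν μ (n + 1)},
      ∀ x' ∈ {x | y₀ + x ∈ finiteSet ν μ (n + 1)}, x ≤ x' → p x ≤ p x' :=
    fun x hx x' hx' h => (strictMonoOn_q hθ hθ' (n + 1)).monotoneOn hx hx' (by linarith)
  -- A is the tangent's value at 0, which rises as the contact point `p x` ≥ 0 moves right.
  have hAmono : MonotoneOn A {x | y₀ + x ∈ finiteSet ν μ (n + 1)} := by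
    intro x hx x' hx' h
    have e1 := hpS x hx x' hx' h
    have e2 := hs e1
    have e3 := hsup (p x') (p x)
    have e4 : 0 ≤ p x := hq0 _
    simp only [hAdef]
    nlinarith
  -- A + D is the tangent's value at 1, which falls as the contact point `p x` ≤ 1 moves right.
  have hCanti : AntitoneOn (fun x => A x + D x) {x | y₀ + x ∈ finiteSet ν μ (n + 1)} := by
    intro x hx x' hx' h
    have e1 := hpS x hx x' hx' h
    have e2 := hs e1
    have e3 := hsup (p x) (p x')
    have e4 : p x' ≤ 1 := hq1 _
    simp only [hAdef, hDdef]
    nlinarith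
  have key : ∀ y ∈ finiteSet ν μ n, ∫ z, F (q ν μ θ₀ (n + 1) (y + z.2)) ∂joint ν μ n y ≤
      ∫ u, risk ν θ₀ A D u ∂posterior ν μ n y := by
    intro y hy
    rw [← integral_risk_posterior hν hμ θ₀ hy hA hD hA1 hD1]
    refine integral_mono (integrable_of_abs_le (by fun_prop) fun z => hF1 _)
      (integrable_of_abs_le (by fun_prop) (L := |F 0| + K + K + K) fun z => ?_) fun z => ?_
    · refine (abs_add_le _ _).trans (add_le_add (hA1 _) ?_)
      rw [abs_mul, abs_of_nonneg (hq0 _)]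
      exact (mul_le_of_le_one_left (abs_nonneg _) (hq1 _)).trans (hD1 _)
    · have := hsup (p z.2) (q ν μ θ₀ (n + 1) (y + z.2))
      simp only [hAdef, hDdef]
      linarith
  have key0 : ∫ z, F (q ν μ θ₀ (n + 1) (y₀ + z.2)) ∂joint ν μ n y₀ =
      ∫ u, risk ν θ₀ A D u ∂posterior ν μ n y₀ := by
    rw [← integral_risk_posterior hν hμ θ₀ h0 hA hD hA1 hD1]
    refine integral_congr_ae (Filter.Eventually.of_forall fun z => ?_)
    simp only [hAdef, hDdef, hp]
    ring
  have hmix := integral_posterior_mix_le hθ.ne' hθ'.ne' hμ h0 h1 h2 ha hb hab hq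
    (measurable_risk θ₀ hA hD) (L := |F 0| + K + K + K)
    (fun u => abs_integral_le_of_abs_le fun x => abs_add_indicator_mul_le hA1 hD1 u x)
    (risk_monotoneOn hν θ₀ hA hA1 hS hAmono)
    (risk_antitoneOn hν θ₀ hA hD hA1 hD1 hS hCanti)
  dsimp only
  rw [key0]
  exact (add_le_add (mul_le_mul_of_nonneg_left (key y₁ h1) ha)
    (mul_le_mul_of_nonneg_left (key y₂ h2) hb)).trans hmix

theorem convex_image_q [SFinite ν] [SFinite μ] [NeZero μ] {θ₀ : ℝ} (h0 : 0 < μ (Ioi θ₀))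
    (n : ℕ) : Convex ℝ (q ν μ θ₀ n '' interior (finiteSet ν μ n)) := by
  have h1 : Convex ℝ (interior (finiteSet ν μ n)) := (ordConnected_finiteSet n).convex.interior
  exact (h1.isPreconnected.image _ (continuousOn_q h0 n)).ordConnected.convex

/-- The one-step expectation preserves concavity in the coordinate `q`. -/
theorem QConcave.integral (hν : ν ≠ 0) [SFinite ν] [SFinite μ] [NeZero μ]
    (hμ : ∀ᵐ u ∂μ, u ∈ paramSet ν) {θ₀ : ℝ} (hθ : 0 < μ (Ioi θ₀)) (hθ' : 0 < μ (Iic θ₀))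
    {n : ℕ} {h : ℝ → ℝ} (hh0 : ∀ y, 0 ≤ h y) (hh1 : ∀ y, h y ≤ 1)
    (hh : QConcave ν μ θ₀ (n + 1) h) :
    QConcave ν μ θ₀ n fun y => ∫ z, h (y + z.2) ∂joint ν μ n y := by
  intro y₀ y₁ y₂ h0 h1 h2 a b ha hb hab hq
  have : NeZero ν := ⟨hν⟩
  obtain ⟨x₀, hx₀⟩ := (ae_add_mem_interior hν hμ h0).exists
  have : Nonempty (interior (finiteSet ν μ (n + 1))) := ⟨⟨_, hx₀⟩⟩
  set f : interior (finiteSet ν μ (n + 1)) → ℝ := fun i => q ν μ θ₀ (n + 1) i with hf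
  set g : interior (finiteSet ν μ (n + 1)) → ℝ := fun i => h i with hg
  have hg1 : ∀ i, g i ≤ 1 := fun i => hh1 i
  have hmix : ∀ i j a b, 0 ≤ a → 0 ≤ b → a + b = 1 →
      ∃ k, f k = a * f i + b * f j ∧ a * g i + b * g j ≤ g k := by
    intro i j a b ha hb hab
    obtain ⟨k, hk, hk'⟩ := convex_image_q (ν := ν) hθ (n + 1) (mem_image_of_mem _ i.2)
      (mem_image_of_mem _ j.2) ha hb hab
    exact ⟨⟨k, hk⟩, hk', hh hk i.2 j.2 ha hb hab hk'⟩
  -- As a function of `q`, h may have unbounded slopes near the ends of its range, so it is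
  -- approximated by envelopes that are K-Lipschitz on the whole line.
  have hlim : ∀ y ∈ interior (finiteSet ν μ n), Filter.Tendsto
      (fun K : ℕ => ∫ z, lipEnvelope f g K (q ν μ θ₀ (n + 1) (y + z.2)) ∂joint ν μ n y)
      Filter.atTop (nhds (∫ z, h (y + z.2) ∂joint ν μ n y)) := by
    intro y hy
    have hae := ae_joint_of_ae (μ := μ) (n := n) (y := y) hν hμ (ae_add_mem_interior hν hμ hy)
    refine tendsto_integral_of_dominated_convergence (fun _ => 1) (fun K => ?_)
      (integrable_const _) (fun K => ?_) ?_
    · have hlip : LipschitzWith (K : NNReal) (lipEnvelope f g K) :=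
        LipschitzWith.of_dist_le_mul fun p r => by
          simpa [Real.dist_eq] using lipEnvelope_lipschitz (f := f) hg1 (Nat.cast_nonneg K) p r
      exact (hlip.continuous.measurable.comp ((measurable_q θ₀ (n + 1)).comp
        (measurable_snd.const_add y))).aestronglyMeasurable
    -- The envelope need not be bounded below by -1 everywhere, but at interior states it lies above
    -- h ≥ 0.
    · filter_upwards [hae] with z hz
      rw [Real.norm_eq_abs, abs_le]
      have e1 := le_lipEnvelope (f := f) hg1 (Nat.cast_nonneg K) ⟨_, hz⟩
      have e2 := hh0 (y + z.2)
      have e3 := lipEnvelope_le_one (f := f) hg1 (Nat.cast_nonneg K) (q ν μ θ₀ (n + 1) (y + z.2))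
      simp only [hf, hg] at e1 e3 ⊢
      exact ⟨by linarith, e3⟩
    -- An interior state has neighbours on both sides, hence finite slopes, and the envelope equals
    -- h there once K exceeds them.
    · filter_upwards [hae] with z hz
      obtain ⟨l, r, hlr, hsub⟩ :=
        mem_nhds_iff_exists_Ioo_subset.1 (isOpen_interior.mem_nhds hz)
      obtain ⟨l', hl'⟩ := exists_between hlr.1
      obtain ⟨r', hr'⟩ := exists_between hlr.2
      have hl : l' ∈ interior (finiteSet ν μ (n + 1)) := hsub ⟨hl'.1, hl'.2.trans hlr.2⟩
      have hr : r' ∈ interior (finiteSet ν μ (n + 1)) := hsub ⟨hlr.1.trans hr'.1, hr'.2⟩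
      have hmono := strictMonoOn_q (ν := ν) hθ hθ' (n + 1)
      obtain ⟨K₀, hK₀, hb⟩ := exists_slope_bound (f := f) (g := g) (i := ⟨_, hz⟩) (l := ⟨l', hl⟩)
        (r := ⟨r', hr⟩) (fun i => hh0 i) hg1
        (fun k i j a b ha hb hab hk => hh k.2 i.2 j.2 ha hb hab hk)
        (hmono (interior_subset hl) (interior_subset hz) hl'.2)
        (hmono (interior_subset hz) (interior_subset hr) hr'.1)
      refine tendsto_const_nhds.congr' ?_
      filter_upwards [Filter.eventually_ge_atTop ⌈K₀⌉₊] with K hK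
      have hK' : K₀ ≤ K := (Nat.le_ceil K₀).trans (by exact_mod_cast hK)
      exact (lipEnvelope_eq (f := f) hg1 (Nat.cast_nonneg K) (i := ⟨_, hz⟩) fun j =>
        (hb j).trans (by gcongr)).symm
  refine le_of_tendsto_of_tendsto' (((hlim y₁ h1).const_mul a).add ((hlim y₂ h2).const_mul b))
    (hlim y₀ h0) fun K => ?_
  exact qconcave_integral_of_lipschitz hν hμ hθ hθ'
    (concaveOn_lipEnvelope (f := f) hg1 (Nat.cast_nonneg K) hmix)
    (lipEnvelope_lipschitz (f := f) hg1 (Nat.cast_nonneg K)) n h0 h1 h2 ha hb hab hq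

end ConcavityStep

/-! ### Splitting off the first term of an i.i.d. sequence. -/

section Sequences

/-- Prepend an element to a sequence. -/
def consSeq (x : ℝ) (z : ℕ → ℝ) : ℕ → ℝ := fun i => Nat.casesOn i x z

@[simp] theorem consSeq_zero (x : ℝ) (z : ℕ → ℝ) : consSeq x z 0 = x := rfl

@[simp] theorem consSeq_succ (x : ℝ) (z : ℕ → ℝ) (i : ℕ) : consSeq x z (i + 1) = z i := rfl

theorem measurable_consSeq : Measurable fun p : ℝ × (ℕ → ℝ) => consSeq p.1 p.2 := by
  refine measurable_pi_lambda _ fun i => ?_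
  cases i with
  | zero => exact measurable_fst
  | succ i => exact (measurable_pi_apply i).comp measurable_snd

theorem infinitePi_eq_map_consSeq (m : Measure ℝ) [IsProbabilityMeasure m] :
    Measure.infinitePi (fun _ : ℕ => m) =
      (m.prod (Measure.infinitePi fun _ : ℕ => m)).map fun p => consSeq p.1 p.2 := by
  refine (Measure.eq_infinitePi _ fun s t ht => ?_).symm
  classical
  -- The cylinder is padded by `univ` to an initial segment of indices, so that the first factor
  -- splits off even if `0 ∉ s`.
  obtain ⟨N, hN⟩ : ∃ N, s ⊆ Finset.range (N + 1) :=
    ⟨s.sup id, fun i hi => Finset.mem_range_succ_iff.2 (Finset.le_sup (f := id) hi)⟩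
  set t' : ℕ → Set ℝ := fun i => if i ∈ s then t i else univ with ht'
  have htm : ∀ i, MeasurableSet (t' i) := fun i => by
    simp only [ht']
    split_ifs
    exacts [ht i, MeasurableSet.univ]
  have hpre : (fun p : ℝ × (ℕ → ℝ) => consSeq p.1 p.2) ⁻¹' (s : Set ℕ).pi t =
      t' 0 ×ˢ ((Finset.range N : Finset ℕ) : Set ℕ).pi fun i => t' (i + 1) := by
    ext ⟨x, z⟩
    simp only [mem_preimage, mem_prod, Set.mem_pi, Finset.mem_coe, ht']
    constructor
    · intro h
      refine ⟨?_, fun i _ => ?_⟩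
      · split_ifs with h0
        exacts [h 0 h0, mem_univ _]
      · split_ifs with h0
        exacts [h (i + 1) h0, mem_univ _]
    · rintro ⟨h0, h1⟩ i hi
      cases i with
      | zero => simpa [hi] using h0
      | succ i =>
        have := h1 i (by have := Finset.mem_range.1 (hN hi); exact Finset.mem_range.2 (by omega))
        simpa [hi] using this
  rw [Measure.map_apply measurable_consSeq
    (MeasurableSet.pi s.countable_toSet fun i _ => ht i), hpre, Measure.prod_prod,
    Measure.infinitePi_pi _ fun i _ => htm (i + 1), mul_comm,
    ← Finset.prod_range_succ' (fun i => m (t' i)) N]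
  rw [← Finset.prod_subset hN]
  · refine Finset.prod_congr rfl fun i hi => ?_
    simp [ht', hi]
  · intro i _ hi
    simp [ht', hi]

theorem lintegral_seqKernel (ν : Measure ℝ) [SFinite ν] (u : ℝ) {f : (ℕ → ℝ) → ℝ≥0∞}
    (hf : Measurable f) :
    ∫⁻ z, f z ∂seqKernel ν u =
      ∫⁻ x, ∫⁻ z, f (consSeq x z) ∂seqKernel ν u ∂obsLaw ν u := by
  change ∫⁻ z, f z ∂Measure.infinitePi (fun _ : ℕ => obsLaw ν u) = ∫⁻ x, ∫⁻ z, f (consSeq x z)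
    ∂Measure.infinitePi (fun _ : ℕ => obsLaw ν u) ∂obsLaw ν u
  conv_lhs => rw [infinitePi_eq_map_consSeq, lintegral_map hf measurable_consSeq]
  exact lintegral_prod _ (hf.comp measurable_consSeq).aemeasurable

end Sequences

/-! ### The path law, its Markov property and the posterior process. -/

section Path

variable {ν μ : Measure ℝ}

/-- The law of the parameter and all future observations, started from the state `(n, y)`. -/
noncomputable def path (ν μ : Measure ℝ) [SFinite ν] (n : ℕ) (y : ℝ) : Measure (ℝ × (ℕ → ℝ)) :=
  (posterior ν μ n y).compProd (seqKernel ν)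

theorem isProb_path [SFinite ν] [NeZero μ] {n : ℕ} {y : ℝ} (hy : y ∈ finiteSet ν μ n) :
    IsProbabilityMeasure (path ν μ n y) := by
  have := isProb_posterior hy
  unfold path; infer_instance

/-- The Markov property: after one observation `x`, the process restarts from `(n + 1, y + x)`. -/
theorem lintegral_path (hν : ν ≠ 0) [SFinite ν] [SFinite μ] [NeZero μ]
    (hμ : ∀ᵐ u ∂μ, u ∈ paramSet ν) {n : ℕ} {y : ℝ} (hy : y ∈ finiteSet ν μ n)
    {f : ℝ × (ℕ → ℝ) → ℝ≥0∞} (hf : Measurable f) :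
    ∫⁻ ω, f ω ∂path ν μ n y =
      ∫⁻ z, ∫⁻ ω, f (ω.1, consSeq z.2 ω.2) ∂path ν μ (n + 1) (y + z.2) ∂joint ν μ n y := by
  have hfu : ∀ u, Measurable fun z => f (u, z) := fun u =>
    hf.comp (measurable_const.prodMk measurable_id)
  have hm : Measurable fun p : (ℝ × ℝ) × (ℕ → ℝ) => f (p.1.1, consSeq p.1.2 p.2) :=
    hf.comp ((measurable_fst.comp measurable_fst).prodMk
      (measurable_consSeq.comp ((measurable_snd.comp measurable_fst).prodMk measurable_snd)))
  have hG : Measurable fun p : ℝ × ℝ => ∫⁻ z, f (p.1, consSeq p.2 z) ∂seqKernel ν p.1 :=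
    hm.lintegral_kernel_prod_right' (κ := (seqKernel ν).comap Prod.fst measurable_fst)
  have h1 : ∫⁻ ω, f ω ∂path ν μ n y =
      ∫⁻ z, ∫⁻ w, f (z.1, consSeq z.2 w) ∂seqKernel ν z.1 ∂joint ν μ n y := by
    rw [path, Measure.lintegral_compProd hf, joint, Measure.lintegral_compProd hG]
    exact lintegral_congr fun u => lintegral_seqKernel ν u (hfu u)
  rw [h1, lintegral_joint_posterior hν hμ hy hG]
  refine lintegral_congr fun z => ?_
  rw [path, Measure.lintegral_compProd (f := fun ω => f (ω.1, consSeq z.2 ω.2))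
    (hm.comp ((measurable_fst.prodMk measurable_const).prodMk measurable_snd))]

theorem lintegral_path_fst [SFinite ν] [SFinite μ] {n : ℕ} {y : ℝ} {f : ℝ → ℝ≥0∞}
    (hf : Measurable f) : ∫⁻ ω, f ω.1 ∂path ν μ n y = ∫⁻ u, f u ∂posterior ν μ n y := by
  have hf' : Measurable fun ω : ℝ × (ℕ → ℝ) => f ω.1 := hf.comp measurable_fst
  rw [path, Measure.lintegral_compProd hf']
  simp

/-- The sufficient statistic after `k` further observations. -/
def stat (y : ℝ) (k : ℕ) (ω : ℝ × (ℕ → ℝ)) : ℝ := y + ∑ i ∈ Finset.range k, ω.2 i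

theorem measurable_stat (y : ℝ) (k : ℕ) : Measurable (stat y k) := by
  unfold stat
  fun_prop

theorem stat_consSeq (y x : ℝ) (k : ℕ) (ω : ℝ × (ℕ → ℝ)) :
    stat y (k + 1) (ω.1, consSeq x ω.2) = stat (y + x) k ω := by
  simp only [stat, Finset.sum_range_succ', consSeq_succ, consSeq_zero]
  ring

/-- Prepend an element to a finite sequence. -/
def consFin {k : ℕ} (x : ℝ) (w : Fin k → ℝ) : Fin (k + 1) → ℝ := Fin.cases x w

theorem measurable_consFin {k : ℕ} (x : ℝ) : Measurable (consFin (k := k) x) := by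
  refine measurable_pi_lambda _ fun i => ?_
  refine Fin.cases ?_ (fun i => ?_) i
  · exact measurable_const
  · exact measurable_pi_apply i

theorem restrict_consSeq {k : ℕ} (x : ℝ) (z : ℕ → ℝ) :
    (fun i : Fin (k + 1) => consSeq x z i) = consFin x fun i : Fin k => z i := by
  funext i
  refine Fin.cases ?_ (fun i => ?_) i <;> rfl

theorem measurable_restrict_snd (k : ℕ) :
    Measurable fun (ω : ℝ × (ℕ → ℝ)) (i : Fin k) => ω.2 i := by
  fun_prop

/-- After `k` observations the posterior distribution is the one with parameters `n + k` and
`stat y k`. -/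
theorem lintegral_path_indicator_mul (hν : ν ≠ 0) [SFinite ν] [SFinite μ] [NeZero μ]
    (hμ : ∀ᵐ u ∂μ, u ∈ paramSet ν) (θ₀ : ℝ) (k : ℕ) :
    ∀ {n : ℕ} {y : ℝ}, y ∈ finiteSet ν μ n → ∀ {h : (Fin k → ℝ) → ℝ≥0∞}, Measurable h →
    ∫⁻ ω, (Ioi θ₀).indicator 1 ω.1 * h (fun i => ω.2 i) ∂path ν μ n y =
      ∫⁻ ω, ENNReal.ofReal (q ν μ θ₀ (n + k) (stat y k ω)) * h (fun i => ω.2 i) ∂path ν μ n y := by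
  have hi : Measurable ((Ioi θ₀).indicator (1 : ℝ → ℝ≥0∞)) :=
    measurable_one.indicator measurableSet_Ioi
  induction k with
  | zero =>
    intro n y hy h hh
    have := isProb_path hy
    have e : ∀ ω : ℝ × (ℕ → ℝ), (fun i : Fin 0 => ω.2 i) = default := fun ω =>
      Subsingleton.elim _ _
    simp only [e, stat, Finset.range_zero, Finset.sum_empty, add_zero]
    have hi' : Measurable fun ω : ℝ × (ℕ → ℝ) => (Ioi θ₀).indicator (1 : ℝ → ℝ≥0∞) ω.1 :=
      hi.comp measurable_fst
    rw [lintegral_mul_const _ hi', lintegral_path_fst hi,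
      lintegral_indicator_one measurableSet_Ioi, lintegral_const, measure_univ, mul_one, q,
      ofReal_measureReal]
  | succ k ih =>
    intro n y hy h hh
    have hq := measurable_q (ν := ν) (μ := μ) θ₀ (n + (k + 1))
    have hh' := hh.comp (measurable_restrict_snd (k + 1))
    refine (lintegral_path hν hμ hy ((hi.comp measurable_fst).mul hh')).trans (Eq.trans ?_
      (lintegral_path hν hμ hy
        ((hq.comp (measurable_stat y (k + 1))).ennreal_ofReal.mul hh')).symm)
    refine lintegral_congr_ae ?_
    filter_upwards [ae_joint_of_ae hν hμ (ae_add_mem_finiteSet hν hμ hy)] with z hz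
    have := ih hz (hh.comp (measurable_consFin z.2))
    simpa only [Function.comp_def, stat_consSeq, restrict_consSeq, Pi.mul_apply,
      add_assoc, add_comm 1 k] using this

/-- The posterior process is the function `q` of the current state: it is measurable in the first k
observations and has the right integral over every event they determine. -/
theorem condExp_path (hν : ν ≠ 0) [SFinite ν] [SFinite μ] [NeZero μ]
    (hμ : ∀ᵐ u ∂μ, u ∈ paramSet ν) (θ₀ : ℝ) (k : ℕ) {n : ℕ} {y : ℝ}
    (hy : y ∈ finiteSet ν μ n) :
    (path ν μ n y)[indicator {ω | θ₀ < ω.1} (fun _ => (1 : ℝ)) | obsFiltration k] =ᵐ[path ν μ n y]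
      fun ω => q ν μ θ₀ (n + k) (stat y k ω) := by
  have := isProb_path hy
  have hq := measurable_q (ν := ν) (μ := μ) θ₀ (n + k)
  have hset : MeasurableSet {ω : ℝ × (ℕ → ℝ) | θ₀ < ω.1} :=
    measurableSet_lt measurable_const measurable_fst
  have hqs : Measurable fun ω => q ν μ θ₀ (n + k) (stat y k ω) := hq.comp (measurable_stat y k)
  have hqint : Integrable (fun ω => q ν μ θ₀ (n + k) (stat y k ω)) (path ν μ n y) :=
    integrable_of_abs_le hqs (L := 1) fun ω => by
      rw [abs_of_nonneg (q_nonneg _ _ _)]; exact q_le_one _ _ _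
  refine (ae_eq_condExp_of_forall_setIntegral_eq (obsFiltration.le k)
    ((integrable_const (1 : ℝ)).indicator hset) (fun s _ _ => hqint.integrableOn) ?_ ?_).symm
  · rintro _ ⟨D, hD, rfl⟩ -
    have hDm : MeasurableSet ((fun (ω : ℝ × (ℕ → ℝ)) (i : Fin k) => ω.2 i) ⁻¹' D) :=
      measurable_restrict_snd k hD
    have h := lintegral_path_indicator_mul hν hμ θ₀ k hy (h := D.indicator 1)
      (measurable_one.indicator hD)
    rw [integral_eq_lintegral_of_nonneg_ae (Filter.Eventually.of_forall fun ω => q_nonneg _ _ _)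
        hqs.aestronglyMeasurable,
      integral_eq_lintegral_of_nonneg_ae
        (Filter.Eventually.of_forall fun ω => indicator_nonneg (fun _ _ => zero_le_one) ω)
        (measurable_const.indicator hset).aestronglyMeasurable,
      ← lintegral_indicator hDm, ← lintegral_indicator hDm]
    congr 1
    convert h.symm using 1
    · refine lintegral_congr fun ω => ?_
      by_cases hω : (fun i : Fin k => ω.2 i) ∈ D <;> simp [hω, indicator]
    · refine lintegral_congr fun ω => ?_
      by_cases hω : (fun i : Fin k => ω.2 i) ∈ D <;> by_cases hθ : θ₀ < ω.1 <;>
        simp [hω, hθ, indicator]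
  · have : StronglyMeasurable[obsFiltration k] fun ω : ℝ × (ℕ → ℝ) =>
        q ν μ θ₀ (n + k) (y + ∑ i : Fin k, ω.2 i) := by
      refine Measurable.stronglyMeasurable ?_
      refine Measurable.comp (g := fun w : Fin k → ℝ => q ν μ θ₀ (n + k) (y + ∑ i : Fin k, w i))
        (by fun_prop) (comap_measurable _)
    refine this.aestronglyMeasurable.congr (Filter.Eventually.of_forall fun ω => ?_)
    simp only [stat, Finset.sum_range]

end Path

/-! ### Dynamic programming: the value as a limit of finite-horizon values. -/

section DynamicProgramming

variable {ν μ : Measure ℝ}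

/-- The expected terminal cost in the state `(n, y)`. -/
noncomputable def stopLoss (ν μ : Measure ℝ) (θ₀ : ℝ) (n : ℕ) (y : ℝ) : ℝ :=
  min (q ν μ θ₀ n y) (1 - q ν μ θ₀ n y)

theorem stopLoss_nonneg (θ₀ : ℝ) (n : ℕ) (y : ℝ) : 0 ≤ stopLoss ν μ θ₀ n y :=
  le_min (q_nonneg _ _ _) (sub_nonneg.2 (q_le_one _ _ _))

theorem stopLoss_le_one (θ₀ : ℝ) (n : ℕ) (y : ℝ) : stopLoss ν μ θ₀ n y ≤ 1 :=
  (min_le_left _ _).trans (q_le_one _ _ _)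

theorem measurable_stopLoss [SFinite ν] [SFinite μ] (θ₀ : ℝ) (n : ℕ) :
    Measurable (stopLoss ν μ θ₀ n) :=
  (measurable_q θ₀ n).min ((measurable_q θ₀ n).const_sub 1)

/-- The value function of the problem with at most `k` further observations. -/
noncomputable def val (ν μ : Measure ℝ) [SFinite ν] (θ₀ c : ℝ) : ℕ → ℕ → ℝ → ℝ
  | 0, n, y => stopLoss ν μ θ₀ n y
  | k + 1, n, y =>
    min (stopLoss ν μ θ₀ n y) (c + ∫ z, val ν μ θ₀ c k (n + 1) (y + z.2) ∂joint ν μ n y)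

theorem val_nonneg [SFinite ν] (θ₀ : ℝ) {c : ℝ} (hc : 0 ≤ c) (k n : ℕ) (y : ℝ) :
    0 ≤ val ν μ θ₀ c k n y := by
  induction k generalizing n y with
  | zero => exact stopLoss_nonneg _ _ _
  | succ k ih =>
    exact le_min (stopLoss_nonneg _ _ _) (add_nonneg hc (integral_nonneg fun z => ih _ _))

theorem val_le_stopLoss [SFinite ν] (θ₀ c : ℝ) (k n : ℕ) (y : ℝ) :
    val ν μ θ₀ c k n y ≤ stopLoss ν μ θ₀ n y := by
  cases k with
  | zero => exact le_rfl
  | succ k => exact min_le_left _ _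

theorem val_le_one [SFinite ν] (θ₀ c : ℝ) (k n : ℕ) (y : ℝ) : val ν μ θ₀ c k n y ≤ 1 :=
  (val_le_stopLoss _ _ _ _ _).trans (stopLoss_le_one _ _ _)

theorem measurable_integral_joint [SFinite ν] [SFinite μ] (n : ℕ) {h : ℝ → ℝ} (hh : Measurable h) :
    Measurable fun y => ∫ z, h (y + z.2) ∂joint ν μ n y := by
  have : Measurable fun p : ℝ × (ℝ × ℝ) => h (p.1 + p.2.2) := by fun_prop
  exact (this.stronglyMeasurable.integral_kernel_prod_right' (κ := jointKernel ν μ n)).measurable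

theorem measurable_val [SFinite ν] [SFinite μ] (θ₀ c : ℝ) (k n : ℕ) :
    Measurable (val ν μ θ₀ c k n) := by
  induction k generalizing n with
  | zero => exact measurable_stopLoss _ _
  | succ k ih =>
    exact (measurable_stopLoss _ _).min ((measurable_integral_joint n (ih (n + 1))).const_add c)

/-- Backward induction: the stopping loss is concave in `q`, and expectation, adding a constant and
taking a minimum keep concavity. -/
theorem qconcave_val (hν : ν ≠ 0) [SFinite ν] [SFinite μ] [NeZero μ]
    (hμ : ∀ᵐ u ∂μ, u ∈ paramSet ν) {θ₀ : ℝ} (hθ : 0 < μ (Ioi θ₀)) (hθ' : 0 < μ (Iic θ₀))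
    {c : ℝ} (hc : 0 ≤ c) (k n : ℕ) : QConcave ν μ θ₀ n (val ν μ θ₀ c k n) := by
  have hloss : ∀ n, QConcave ν μ θ₀ n (stopLoss ν μ θ₀ n) := fun n => by
    have h1 : ConcaveOn ℝ univ fun p : ℝ => p := concaveOn_id convex_univ
    have h2 : ConcaveOn ℝ univ fun p : ℝ => 1 - p :=
      (concaveOn_const 1 convex_univ).sub (convexOn_id convex_univ)
    exact (qconcave_comp h1 θ₀ n).min (qconcave_comp h2 θ₀ n)
  induction k generalizing n with
  | zero => exact hloss n
  | succ k ih =>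
    exact (hloss n).min ((QConcave.integral hν hμ hθ hθ' (val_nonneg θ₀ hc k (n + 1))
      (val_le_one θ₀ c k (n + 1)) (ih (n + 1))).const_add c)

/-- The expected cost of the stopping rule `τ`, started from the state `(n, y)`. -/
noncomputable def stateCost (ν μ : Measure ℝ) [SFinite ν] (θ₀ c : ℝ) (n : ℕ) (y : ℝ)
    (τ : ℝ × (ℕ → ℝ) → ℕ) : ℝ≥0∞ :=
  ∫⁻ ω, ENNReal.ofReal (stopLoss ν μ θ₀ (n + τ ω) (stat y (τ ω) ω) + c * τ ω) ∂path ν μ n y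

theorem measurable_eval_nat {α β : Type*} [MeasurableSpace α] [MeasurableSpace β]
    {F : ℕ → α → β} (hF : ∀ k, Measurable (F k)) {τ : α → ℕ} (hτ : Measurable τ) :
    Measurable fun x => F (τ x) x := by
  have h : Measurable fun p : ℕ × α => F p.1 p.2 := measurable_from_prod_countable_right hF
  exact h.comp (hτ.prodMk measurable_id)

theorem measurable_stateCost_integrand [SFinite ν] [SFinite μ] (θ₀ c : ℝ) (n : ℕ) (y : ℝ)
    {τ : ℝ × (ℕ → ℝ) → ℕ} (hτ : Measurable τ) : Measurable fun ω =>
      ENNReal.ofReal (stopLoss ν μ θ₀ (n + τ ω) (stat y (τ ω) ω) + c * τ ω) := by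
  refine measurable_eval_nat (F := fun k ω =>
    ENNReal.ofReal (stopLoss ν μ θ₀ (n + k) (stat y k ω) + c * k)) (fun k => ?_) hτ
  have hk : Measurable fun ω => stopLoss ν μ θ₀ (n + k) (stat y k ω) :=
    (measurable_stopLoss θ₀ (n + k)).comp (measurable_stat y k)
  exact (hk.add_const (c * k)).ennreal_ofReal

theorem measurable_of_isStoppingTime {τ : ℝ × (ℕ → ℝ) → ℕ}
    (hτ : IsStoppingTime obsFiltration fun ω => (τ ω : WithTop ℕ)) : Measurable τ := by
  refine measurable_of_Iic fun i => ?_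
  have := obsFiltration.le i _ (hτ i)
  convert this using 1
  ext ω
  exact (Nat.cast_le (α := WithTop ℕ) (m := τ ω) (n := i)).symm

/-- After the first observation `x`, a stopping time which is at least one is a stopping time for
the remaining observations. -/
theorem isStoppingTime_consSeq {τ : ℝ × (ℕ → ℝ) → ℕ}
    (hτ : IsStoppingTime obsFiltration fun ω => (τ ω : WithTop ℕ)) (x : ℝ) :
    IsStoppingTime obsFiltration
      fun ω => ((τ (ω.1, consSeq x ω.2) - 1 : ℕ) : WithTop ℕ) := by
  intro k
  obtain ⟨D, hD, hDeq⟩ := hτ (k + 1)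
  refine ⟨consFin x ⁻¹' D, measurable_consFin x hD, ?_⟩
  ext ω
  have h := Set.ext_iff.1 hDeq (ω.1, consSeq x ω.2)
  simp only [mem_preimage, restrict_consSeq] at h
  refine h.trans ?_
  change ((τ (ω.1, consSeq x ω.2) : ℕ) : WithTop ℕ) ≤ ((k + 1 : ℕ) : WithTop ℕ) ↔
    ((τ (ω.1, consSeq x ω.2) - 1 : ℕ) : WithTop ℕ) ≤ ((k : ℕ) : WithTop ℕ)
  rw [Nat.cast_le, Nat.cast_le]
  -- Truncated subtraction makes the equivalence hold at τ = 0 too.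
  exact (tsub_le_iff_right).symm

/-- The σ-algebra at time 0 comes from a map into a one-point space, so stopping at once is decided
without looking at ω. -/
theorem isStoppingTime_zero_or_pos {τ : ℝ × (ℕ → ℝ) → ℕ}
    (hτ : IsStoppingTime obsFiltration fun ω => (τ ω : WithTop ℕ)) :
    (∀ ω, τ ω = 0) ∨ ∀ ω, 1 ≤ τ ω := by
  obtain ⟨D, -, hDeq⟩ := hτ 0
  have h : ∀ ω, (default : Fin 0 → ℝ) ∈ D ↔ τ ω = 0 := fun ω => by
    have h := Set.ext_iff.1 hDeq ω
    rw [mem_preimage, Subsingleton.elim (fun i : Fin 0 => ω.2 i) default] at h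
    refine h.trans ?_
    change ((τ ω : ℕ) : WithTop ℕ) ≤ ((0 : ℕ) : WithTop ℕ) ↔ _
    rw [Nat.cast_le, nonpos_iff_eq_zero]
  by_cases hD : default ∈ D
  · exact Or.inl fun ω => (h ω).1 hD
  · exact Or.inr fun ω => Nat.one_le_iff_ne_zero.2 fun h0 => hD ((h ω).2 h0)

theorem stateCost_zero [SFinite ν] [NeZero μ] (θ₀ c : ℝ) {n : ℕ} {y : ℝ}
    (hy : y ∈ finiteSet ν μ n) {τ : ℝ × (ℕ → ℝ) → ℕ} (hτ : ∀ ω, τ ω = 0) :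
    stateCost ν μ θ₀ c n y τ = ENNReal.ofReal (stopLoss ν μ θ₀ n y) := by
  have := isProb_path hy
  simp [stateCost, hτ, stat]

/-- Conditioning the expected cost on the first observation. -/
theorem stateCost_of_pos (hν : ν ≠ 0) [SFinite ν] [SFinite μ] [NeZero μ]
    (hμ : ∀ᵐ u ∂μ, u ∈ paramSet ν) (θ₀ : ℝ) {c : ℝ} (hc : 0 ≤ c) {n : ℕ} {y : ℝ}
    (hy : y ∈ finiteSet ν μ n) {τ : ℝ × (ℕ → ℝ) → ℕ} (hτm : Measurable τ) (hτ : ∀ ω, 1 ≤ τ ω) :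
    stateCost ν μ θ₀ c n y τ = ENNReal.ofReal c + ∫⁻ z, stateCost ν μ θ₀ c (n + 1) (y + z.2)
      (fun ω => τ (ω.1, consSeq z.2 ω.2) - 1) ∂joint ν μ n y := by
  have := isProb_joint hy
  have hadd : ENNReal.ofReal c = ∫⁻ _, ENNReal.ofReal c ∂joint ν μ n y := by simp
  rw [hadd, ← lintegral_add_left measurable_const, stateCost,
    lintegral_path hν hμ hy (measurable_stateCost_integrand θ₀ c n y hτm)]
  refine lintegral_congr_ae ?_
  filter_upwards [ae_joint_of_ae hν hμ (ae_add_mem_finiteSet hν hμ hy)] with z hz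
  have := isProb_path hz
  have hadd' : ENNReal.ofReal c = ∫⁻ _, ENNReal.ofReal c ∂path ν μ (n + 1) (y + z.2) := by simp
  rw [hadd', stateCost, ← lintegral_add_left measurable_const]
  refine lintegral_congr fun ω => ?_
  obtain ⟨m, hm⟩ : ∃ m, τ (ω.1, consSeq z.2 ω.2) = m + 1 :=
    ⟨_, (Nat.sub_add_cancel (hτ _)).symm⟩
  rw [hm, Nat.add_sub_cancel, stat_consSeq, ← ENNReal.ofReal_add hc
    (add_nonneg (stopLoss_nonneg _ _ _) (by positivity)), add_assoc n 1 m, add_comm 1 m]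
  congr 1
  push_cast
  ring

theorem ofReal_integral_val [SFinite ν] [SFinite μ] (θ₀ : ℝ) {c : ℝ} (hc : 0 ≤ c)
    (k n : ℕ) (y : ℝ) : ENNReal.ofReal (c + ∫ z, val ν μ θ₀ c k (n + 1) (y + z.2) ∂joint ν μ n y) =
      ENNReal.ofReal c + ∫⁻ z, ENNReal.ofReal (val ν μ θ₀ c k (n + 1) (y + z.2)) ∂joint ν μ n y := by
  have hm : Measurable fun z : ℝ × ℝ => val ν μ θ₀ c k (n + 1) (y + z.2) :=
    (measurable_val θ₀ c k (n + 1)).comp (measurable_snd.const_add y)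
  rw [ENNReal.ofReal_add hc (integral_nonneg fun z => val_nonneg θ₀ hc _ _ _),
    ofReal_integral_eq_lintegral_ofReal _
      (Filter.Eventually.of_forall fun z => val_nonneg θ₀ hc _ _ _)]
  refine integrable_of_abs_le hm (L := 1) fun z => ?_
  rw [abs_of_nonneg (val_nonneg θ₀ hc _ _ _)]
  exact val_le_one _ _ _ _ _

/-- Induction on the horizon: a rule either stops at once, or given the first observation it
continues as a rule with horizon one less. -/
theorem val_le_stateCost (hν : ν ≠ 0) [SFinite ν] [SFinite μ] [NeZero μ]
    (hμ : ∀ᵐ u ∂μ, u ∈ paramSet ν) (θ₀ : ℝ) {c : ℝ} (hc : 0 ≤ c) (k : ℕ) :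
    ∀ {n : ℕ} {y : ℝ}, y ∈ finiteSet ν μ n → ∀ {τ : ℝ × (ℕ → ℝ) → ℕ},
    IsStoppingTime obsFiltration (fun ω => (τ ω : WithTop ℕ)) → (∀ ω, τ ω ≤ k) →
    ENNReal.ofReal (val ν μ θ₀ c k n y) ≤ stateCost ν μ θ₀ c n y τ := by
  induction k with
  | zero =>
    intro n y hy τ _ hk
    rw [stateCost_zero θ₀ c hy fun ω => Nat.le_zero.1 (hk ω), val]
  | succ k ih =>
    intro n y hy τ hτ hk
    rcases isStoppingTime_zero_or_pos hτ with h0 | h1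
    · rw [stateCost_zero θ₀ c hy h0]
      exact ENNReal.ofReal_le_ofReal (val_le_stopLoss _ _ _ _ _)
    · rw [stateCost_of_pos hν hμ θ₀ hc hy (measurable_of_isStoppingTime hτ) h1]
      refine (ENNReal.ofReal_le_ofReal (min_le_right _ _)).trans ?_
      rw [ofReal_integral_val θ₀ hc]
      refine add_le_add_right (lintegral_mono_ae ?_) _
      filter_upwards [ae_joint_of_ae hν hμ (ae_add_mem_finiteSet hν hμ hy)] with z hz
      refine ih hz (isStoppingTime_consSeq hτ z.2) fun ω => ?_
      have := hk (ω.1, consSeq z.2 ω.2)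
      omega

open Classical in
/-- The optimal stopping rule among those which take at most `k` further observations. -/
noncomputable def optRule (ν μ : Measure ℝ) [SFinite ν] (θ₀ c : ℝ) :
    ℕ → ℕ → ℝ → (ℕ → ℝ) → ℕ
  | 0, _, _, _ => 0
  | k + 1, n, y, z =>
    if stopLoss ν μ θ₀ n y ≤ c + ∫ z, val ν μ θ₀ c k (n + 1) (y + z.2) ∂joint ν μ n y then 0
    else optRule ν μ θ₀ c k (n + 1) (y + z 0) (fun i => z (i + 1)) + 1

theorem measurable_optRule [SFinite ν] [SFinite μ] (θ₀ c : ℝ) (k n : ℕ) :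
    Measurable fun p : ℝ × (ℕ → ℝ) => optRule ν μ θ₀ c k n p.1 p.2 := by
  induction k generalizing n with
  | zero => exact measurable_const
  | succ k ih =>
    have hs : MeasurableSet {y | stopLoss ν μ θ₀ n y ≤
        c + ∫ z, val ν μ θ₀ c k (n + 1) (y + z.2) ∂joint ν μ n y} :=
      measurableSet_le (measurable_stopLoss θ₀ n)
        ((measurable_integral_joint n (measurable_val θ₀ c k (n + 1))).const_add c)
    have hmap : Measurable fun p : ℝ × (ℕ → ℝ) => (p.1 + p.2 0, fun i => p.2 (i + 1)) := by
      fun_prop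
    exact Measurable.ite (measurable_fst hs) measurable_const
      (((measurable_of_countable (fun m : ℕ => m + 1)).comp (ih (n + 1))).comp hmap)

/-- A decision to stop by time j uses only the first j observations; this is the stopping-time
property in path form. -/
theorem optRule_congr [SFinite ν] (θ₀ c : ℝ) (k n : ℕ) (y : ℝ) (j : ℕ) {z z' : ℕ → ℝ}
    (h : ∀ i < j, z i = z' i) (hj : optRule ν μ θ₀ c k n y z ≤ j) :
    optRule ν μ θ₀ c k n y z' = optRule ν μ θ₀ c k n y z := by
  induction k generalizing n y j z z' with
  | zero => rfl
  | succ k ih =>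
    simp only [optRule] at hj ⊢
    split_ifs at hj ⊢ with hs
    · rfl
    · obtain ⟨j, rfl⟩ : ∃ j', j = j' + 1 := ⟨j - 1, by omega⟩
      rw [h 0 (Nat.succ_pos j)] at hj ⊢
      rw [ih (n + 1) _ j (fun i hi => h (i + 1) (Nat.succ_lt_succ hi)) (by omega)]

theorem isStoppingTime_optRule [SFinite ν] [SFinite μ] (θ₀ c : ℝ) (k n : ℕ) (y : ℝ) :
    IsStoppingTime obsFiltration fun ω => (optRule ν μ θ₀ c k n y ω.2 : WithTop ℕ) := by
  intro j
  -- The padding value is immaterial, by `optRule_congr`.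
  set ext : (Fin j → ℝ) → ℕ → ℝ := fun w i => if h : i < j then w ⟨i, h⟩ else 0 with hext
  have hm : Measurable ext := by
    refine measurable_pi_lambda _ fun i => ?_
    by_cases h : i < j
    · simp only [hext, h, dif_pos]
      exact measurable_pi_apply _
    · simp only [hext, h, dif_neg, not_false_eq_true]
      exact measurable_const
  have hr : Measurable (optRule ν μ θ₀ c k n y) :=
    (measurable_optRule θ₀ c k n).comp (measurable_const.prodMk measurable_id)
  refine ⟨(fun w => optRule ν μ θ₀ c k n y (ext w)) ⁻¹' Iic j, (hr.comp hm) measurableSet_Iic, ?_⟩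
  ext ω
  have hagree : ∀ i < j, ext (fun i : Fin j => ω.2 i) i = ω.2 i := fun i hi => by
    simp [hext, hi]
  change optRule ν μ θ₀ c k n y (ext fun i : Fin j => ω.2 i) ≤ j ↔
    ((optRule ν μ θ₀ c k n y ω.2 : ℕ) : WithTop ℕ) ≤ ((j : ℕ) : WithTop ℕ)
  rw [Nat.cast_le]
  constructor
  · intro h
    rwa [optRule_congr θ₀ c k n y j hagree h]
  · intro h
    rwa [optRule_congr θ₀ c k n y j (fun i hi => (hagree i hi).symm) h]

theorem stateCost_optRule (hν : ν ≠ 0) [SFinite ν] [SFinite μ] [NeZero μ]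
    (hμ : ∀ᵐ u ∂μ, u ∈ paramSet ν) (θ₀ : ℝ) {c : ℝ} (hc : 0 ≤ c) (k : ℕ) :
    ∀ {n : ℕ} {y : ℝ}, y ∈ finiteSet ν μ n →
    stateCost ν μ θ₀ c n y (fun ω => optRule ν μ θ₀ c k n y ω.2) =
      ENNReal.ofReal (val ν μ θ₀ c k n y) := by
  induction k with
  | zero =>
    intro n y hy
    exact stateCost_zero θ₀ c hy fun _ => rfl
  | succ k ih =>
    intro n y hy
    by_cases hs : stopLoss ν μ θ₀ n y ≤
        c + ∫ z, val ν μ θ₀ c k (n + 1) (y + z.2) ∂joint ν μ n y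
    · rw [stateCost_zero θ₀ c hy fun ω => by simp only [optRule, if_pos hs], val, min_eq_left hs]
    · rw [stateCost_of_pos hν hμ θ₀ hc hy
        (measurable_of_isStoppingTime (isStoppingTime_optRule θ₀ c (k + 1) n y))
        (fun ω => by simp only [optRule, if_neg hs]; omega), val,
        min_eq_right (le_of_lt (not_le.1 hs)), ofReal_integral_val θ₀ hc]
      congr 1
      refine lintegral_congr_ae ?_
      filter_upwards [ae_joint_of_ae hν hμ (ae_add_mem_finiteSet hν hμ hy)] with z hz
      rw [← ih hz]
      simp only [optRule, if_neg hs, consSeq_zero, consSeq_succ, Nat.add_sub_cancel]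

/-- Truncating at k cannot raise the sampling cost, and where τ > k it raises the stopping loss by
at most 1. -/
theorem stateCost_min_le [SFinite ν] [SFinite μ] (θ₀ : ℝ) {c : ℝ} (hc : 0 ≤ c) (n : ℕ) (y : ℝ)
    {τ : ℝ × (ℕ → ℝ) → ℕ} (hτ : Measurable τ) (k : ℕ) :
    stateCost ν μ θ₀ c n y (fun ω => min (τ ω) k) ≤
      stateCost ν μ θ₀ c n y τ + path ν μ n y {ω | k < τ ω} := by
  have hs : MeasurableSet {ω | k < τ ω} := measurableSet_lt measurable_const hτ
  rw [← lintegral_indicator_one hs, stateCost, stateCost,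
    ← lintegral_add_left (measurable_stateCost_integrand θ₀ c n y hτ)]
  refine lintegral_mono fun ω => ?_
  dsimp only
  rcases le_or_gt (τ ω) k with h | h
  · rw [min_eq_left h]
    exact le_self_add
  · have h1 : {ω | k < τ ω}.indicator (1 : ℝ × (ℕ → ℝ) → ℝ≥0∞) ω = ENNReal.ofReal 1 := by
      simp [indicator, h]
    rw [min_eq_right h.le, h1, ← ENNReal.ofReal_add
      (add_nonneg (stopLoss_nonneg _ _ _) (by positivity)) zero_le_one]
    refine ENNReal.ofReal_le_ofReal ?_
    have h2 := stopLoss_le_one (ν := ν) (μ := μ) θ₀ (n + k) (stat y k ω)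
    have h3 := stopLoss_nonneg (ν := ν) (μ := μ) θ₀ (n + τ ω) (stat y (τ ω) ω)
    have h4 : c * k ≤ c * τ ω := by gcongr
    linarith

/-- Since τ is finite, the probability of τ > k tends to zero, so truncation costs nothing in the
limit. -/
theorem iInf_val_le_stateCost (hν : ν ≠ 0) [SFinite ν] [SFinite μ] [NeZero μ]
    (hμ : ∀ᵐ u ∂μ, u ∈ paramSet ν) (θ₀ : ℝ) {c : ℝ} (hc : 0 ≤ c) {n : ℕ} {y : ℝ}
    (hy : y ∈ finiteSet ν μ n) {τ : ℝ × (ℕ → ℝ) → ℕ}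
    (hτ : IsStoppingTime obsFiltration fun ω => (τ ω : WithTop ℕ)) :
    ENNReal.ofReal (⨅ k, val ν μ θ₀ c k n y) ≤ stateCost ν μ θ₀ c n y τ := by
  have := isProb_path hy
  have hτm := measurable_of_isStoppingTime hτ
  have hle : ∀ k, ENNReal.ofReal (⨅ k, val ν μ θ₀ c k n y) ≤
      stateCost ν μ θ₀ c n y τ + path ν μ n y {ω | k < τ ω} := by
    intro k
    have hbd : BddBelow (range fun k => val ν μ θ₀ c k n y) :=
      ⟨0, by rintro _ ⟨k, rfl⟩; exact val_nonneg θ₀ hc _ _ _⟩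
    refine (ENNReal.ofReal_le_ofReal (ciInf_le hbd k)).trans
      (le_trans ?_ (stateCost_min_le θ₀ hc n y hτm k))
    refine val_le_stateCost hν hμ θ₀ hc k hy ?_ fun ω => min_le_right _ _
    have he : (fun ω => ((min (τ ω) k : ℕ) : WithTop ℕ)) =
        fun ω => min (τ ω : WithTop ℕ) (k : WithTop ℕ) := 
      funext fun ω => Nat.mono_cast.map_min
    rw [he]
    exact hτ.min_const k
  have hlim : Filter.Tendsto (fun k => path ν μ n y {ω | k < τ ω}) Filter.atTop (nhds 0) := by
    have h := tendsto_measure_iInter_atTop (μ := path ν μ n y) (s := fun k => {ω | k < τ ω})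
      (fun k => (measurableSet_lt measurable_const hτm).nullMeasurableSet)
      (fun i j hij ω hω => lt_of_le_of_lt hij hω) ⟨0, measure_ne_top _ _⟩
    have he : ⋂ k, {ω | k < τ ω} = ∅ := by
      ext ω
      simp only [mem_iInter, mem_empty_iff_false, iff_false, not_forall]
      exact ⟨τ ω, fun h => lt_irrefl (τ ω) h⟩
    rw [he, measure_empty] at h
    exact h
  have := ge_of_tendsto' (hlim.const_add (stateCost ν μ θ₀ c n y τ)) hle
  simpa using this

/-- The identification of the posterior process holds for all k at once outside one null set, so it
may be evaluated at the random time τ. -/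
theorem cost_eq_stateCost (hν : ν ≠ 0) [SFinite ν] [SFinite μ] [NeZero μ]
    (hμ : ∀ᵐ u ∂μ, u ∈ paramSet ν) (θ₀ c : ℝ) {n : ℕ} {p : ℝ}
    (hy : level ν μ θ₀ n p ∈ finiteSet ν μ n) (τ : ℝ × (ℕ → ℝ) → ℕ) :
    cost ν μ θ₀ c n p τ = stateCost ν μ θ₀ c n (level ν μ θ₀ n p) τ := by
  have h : ∀ᵐ ω ∂path ν μ n (level ν μ θ₀ n p), ∀ k, postProb ν μ θ₀ n p k ω =
      q ν μ θ₀ (n + k) (stat (level ν μ θ₀ n p) k ω) :=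
    ae_all_iff.2 fun k => condExp_path hν hμ θ₀ k hy
  refine lintegral_congr_ae ?_
  filter_upwards [h] with ω hω
  rw [hω, stopLoss]

theorem V_eq_iInf_val (hν : ν ≠ 0) [SFinite ν] [SFinite μ] [NeZero μ]
    (hμ : ∀ᵐ u ∂μ, u ∈ paramSet ν) (θ₀ : ℝ) {c : ℝ} (hc : 0 ≤ c) {n : ℕ} {p : ℝ}
    (hy : level ν μ θ₀ n p ∈ finiteSet ν μ n) :
    V ν μ θ₀ c n p = ⨅ k, val ν μ θ₀ c k n (level ν μ θ₀ n p) := by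
  have hle : ∀ k, (⨅ (τ : ℝ × (ℕ → ℝ) → ℕ)
      (_ : IsStoppingTime obsFiltration fun ω => (τ ω : WithTop ℕ)), cost ν μ θ₀ c n p τ) ≤
      ENNReal.ofReal (val ν μ θ₀ c k n (level ν μ θ₀ n p)) := fun k => by
    rw [← stateCost_optRule hν hμ θ₀ hc k hy, ← cost_eq_stateCost hν hμ θ₀ c hy]
    exact iInf_le_of_le _ (iInf_le_of_le (isStoppingTime_optRule (ν := ν) (μ := μ) θ₀ c k n _) le_rfl)
  have hge : ENNReal.ofReal (⨅ k, val ν μ θ₀ c k n (level ν μ θ₀ n p)) ≤ ⨅ (τ : ℝ × (ℕ → ℝ) → ℕ)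
      (_ : IsStoppingTime obsFiltration fun ω => (τ ω : WithTop ℕ)), cost ν μ θ₀ c n p τ :=
    le_iInf₂ fun τ hτ => by
      rw [cost_eq_stateCost hν hμ θ₀ c hy]
      exact iInf_val_le_stateCost hν hμ θ₀ hc hy hτ
  refine le_antisymm (le_ciInf fun k => ?_) ?_
  · exact ENNReal.toReal_le_of_le_ofReal (val_nonneg (ν := ν) (μ := μ) θ₀ hc _ _ _) (hle k)
  · exact (ENNReal.ofReal_le_iff_le_toReal (ne_top_of_le_ne_top ENNReal.ofReal_ne_top (hle 0))).1 hge

end DynamicProgramming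

/-! ### Concave functions on the unit interval below min(p, 1-p). -/

section ConcaveOnUnitInterval

theorem mix_mem_Ioo {e r a b : ℝ} (he : e ∈ Icc (0 : ℝ) 1) (hr : r ∈ Ioo (0 : ℝ) 1) (ha : 0 ≤ a)
    (hb : 0 < b) (hab : a + b = 1) : a * e + b * r ∈ Ioo (0 : ℝ) 1 := by
  obtain ⟨he0, he1⟩ := he
  obtain ⟨hr0, hr1⟩ := hr
  constructor
  · have := mul_nonneg ha he0
    have := mul_pos hb hr0
    linarith
  · have := mul_le_mul_of_nonneg_left he1 ha
    have := mul_lt_mul_of_pos_left hr1 hb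
    linarith

/-- Here e may be an end point, where f is not controlled. The mixed point is instead written with
weight t < b on r and the rest on an interior point, whose nonnegative contribution is dropped; then
t tends to b. -/
theorem concaveOn_mul_le_of_nonneg {f : ℝ → ℝ} (hf : ConcaveOn ℝ (Ioo 0 1) f)
    (h0 : ∀ p ∈ Ioo (0 : ℝ) 1, 0 ≤ f p) {e r a b : ℝ} (he : e ∈ Icc (0 : ℝ) 1)
    (hr : r ∈ Ioo (0 : ℝ) 1) (ha : 0 < a) (hb : 0 < b) (hab : a + b = 1) :
    b * f r ≤ f (a * e + b * r) := by
  have key : ∀ t, 0 < t → t < b → t * f r ≤ f (a * e + b * r) := by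
    intro t ht htb
    have ht1 : 0 < 1 - t := by linarith
    have hx : a / (1 - t) * e + (b - t) / (1 - t) * r ∈ Ioo (0 : ℝ) 1 :=
      mix_mem_Ioo he hr (by positivity) (div_pos (by linarith) ht1)
        (by field_simp; linarith)
    have h := hf.2 hx hr ht1.le ht.le (by ring)
    have e1 : (1 - t) • (a / (1 - t) * e + (b - t) / (1 - t) * r) + t • r = a * e + b * r := by
      simp only [smul_eq_mul]
      field_simp
      ring
    rw [e1] at h
    simp only [smul_eq_mul] at h
    have := mul_nonneg ht1.le (h0 _ hx)
    linarith
  have hlim : Filter.Tendsto (fun t => t * f r) (nhdsWithin b (Iio b)) (nhds (b * f r)) :=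
    ((continuous_id.mul continuous_const).tendsto b).mono_left nhdsWithin_le_nhds
  refine le_of_tendsto hlim ?_
  filter_upwards [Ioo_mem_nhdsLT hb] with t ht
  exact key t ht.1 ht.2

open Classical in
/-- A nonnegative concave function on `(0, 1)`, extended by zero to the end points, is concave. -/
theorem concaveOn_Icc_ite {f : ℝ → ℝ} (hf : ConcaveOn ℝ (Ioo 0 1) f)
    (h0 : ∀ p ∈ Ioo (0 : ℝ) 1, 0 ≤ f p) :
    ConcaveOn ℝ (Icc 0 1) fun p => if p = 0 ∨ p = 1 then 0 else f p := by
  have hmem : ∀ p ∈ Icc (0 : ℝ) 1, ¬(p = 0 ∨ p = 1) → p ∈ Ioo (0 : ℝ) 1 := fun p hp h => by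
    push Not at h
    exact ⟨lt_of_le_of_ne hp.1 (Ne.symm h.1), lt_of_le_of_ne hp.2 h.2⟩
  have hne : ∀ p ∈ Ioo (0 : ℝ) 1, ¬(p = 0 ∨ p = 1) := fun p hp h => by
    rcases h with rfl | rfl
    exacts [lt_irrefl _ hp.1, lt_irrefl _ hp.2]
  refine ⟨convex_Icc 0 1, fun p hp r hr a b ha hb hab => ?_⟩
  rcases ha.eq_or_lt with rfl | ha
  · simp [(by linarith : b = 1)]
  rcases hb.eq_or_lt with rfl | hb
  · simp [(by linarith : a = 1)]
  simp only [smul_eq_mul]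
  by_cases hp' : p = 0 ∨ p = 1 <;> by_cases hr' : r = 0 ∨ r = 1
  · simp only [if_pos hp', if_pos hr', mul_zero, add_zero]
    split_ifs with h
    · exact le_rfl
    · exact h0 _ (hmem _ ((convex_Icc (0 : ℝ) 1) hp hr ha.le hb.le hab) h)
  · have hr'' := hmem r hr hr'
    rw [if_pos hp', if_neg hr', if_neg (hne _ (mix_mem_Ioo hp hr'' ha.le hb hab)), mul_zero,
      zero_add]
    exact concaveOn_mul_le_of_nonneg hf h0 hp hr'' ha hb hab
  · have hp'' := hmem p hp hp'
    rw [add_comm (a * p)]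
    rw [if_pos hr', if_neg hp', if_neg (hne _ (mix_mem_Ioo hr hp'' hb.le ha (by linarith))),
      mul_zero, add_zero]
    exact concaveOn_mul_le_of_nonneg hf h0 hr hp'' hb ha (by linarith)
  · have hr'' := hmem r hr hr'
    have hp'' := hmem p hp hp'
    rw [if_neg hp', if_neg hr', if_neg (hne _ (mix_mem_Ioo hp hr'' ha.le hb hab))]
    exact hf.2 hp'' hr'' ha.le hb.le hab

/-- The contact set {f p = p} in [0, 1/2] is an initial segment, by chords from (0, 0), and contains
its supremum, by chords to (1, 0). -/
theorem exists_left_boundary {f : ℝ → ℝ} (hf : ConcaveOn ℝ (Icc 0 1) f) (hf0 : f 0 = 0)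
    (hf1 : f 1 = 0) (hle : ∀ p ∈ Icc (0 : ℝ) 1, f p ≤ p) :
    ∃ b ∈ Icc (0 : ℝ) (1 / 2), ∀ p ∈ Icc (0 : ℝ) (1 / 2), f p < p ↔ b < p := by
  set T : Set ℝ := {p | p ∈ Icc (0 : ℝ) (1 / 2) ∧ f p = p} with hT
  have hT0 : (0 : ℝ) ∈ T := ⟨⟨le_rfl, by norm_num⟩, hf0⟩
  have hTb : ∀ t ∈ T, t ≤ 1 / 2 := fun t ht => ht.1.2
  have hbdd : BddAbove T := ⟨1 / 2, hTb⟩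
  have hb0 : 0 ≤ sSup T := le_csSup hbdd hT0
  have hb1 : sSup T ≤ 1 / 2 := csSup_le ⟨0, hT0⟩ hTb
  have hIcc : ∀ p ∈ Icc (0 : ℝ) (1 / 2), p ∈ Icc (0 : ℝ) 1 := fun p hp =>
    ⟨hp.1, hp.2.trans (by norm_num)⟩
  have z0 : (0 : ℝ) ∈ Icc (0 : ℝ) 1 := by simp
  have z1 : (1 : ℝ) ∈ Icc (0 : ℝ) 1 := by simp
  have hcc : ∀ p ∈ Icc (0 : ℝ) 1, ∀ r ∈ Icc (0 : ℝ) 1, ∀ a b : ℝ, 0 ≤ a → 0 ≤ b → a + b = 1 →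
      a * f p + b * f r ≤ f (a * p + b * r) := fun p hp r hr a b ha hb hab => hf.2 hp hr ha hb hab
  have hdown : ∀ t ∈ T, ∀ p, 0 ≤ p → p ≤ t → p ∈ T := by
    intro t ht p hp hpt
    rcases hp.eq_or_lt with rfl | hp
    · exact hT0
    have ht0 : 0 < t := hp.trans_le hpt
    have hpm : p ∈ Icc (0 : ℝ) (1 / 2) := ⟨hp.le, hpt.trans ht.1.2⟩
    refine ⟨hpm, le_antisymm (hle p (hIcc p hpm)) ?_⟩
    have h := hcc 0 z0 t (hIcc t ht.1) (1 - p / t) (p / t)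
      (sub_nonneg.2 ((div_le_one ht0).2 hpt)) (by positivity) (by ring)
    simp only [mul_zero, zero_add, hf0, ht.2, div_mul_cancel₀ p ht0.ne'] at h
    exact h
  have hmem : sSup T ∈ T := by
    have hsm : sSup T ∈ Icc (0 : ℝ) (1 / 2) := ⟨hb0, hb1⟩
    refine ⟨hsm, le_antisymm (hle _ (hIcc _ hsm)) ?_⟩
    have hfs : 0 ≤ f (sSup T) := by
      have h := hcc 0 z0 1 z1 (1 - sSup T) (sSup T) (by linarith) hb0 (by ring)
      simpa [hf0, hf1] using h
    -- With s the supremum, the chord from (t, t) to (1, 0) gives f(s) (1-t) ≥ (1-s) t; this is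
    -- solved for t so that the supremum over t can be taken.
    have hsup : sSup T ≤ f (sSup T) / (1 - sSup T + f (sSup T)) := by
      refine csSup_le ⟨0, hT0⟩ fun t ht => ?_
      have hts : t ≤ sSup T := le_csSup hbdd ht
      have ht1 : 0 < 1 - t := by linarith
      have h := hcc t (hIcc t ht.1) 1 z1 ((1 - sSup T) / (1 - t)) ((sSup T - t) / (1 - t))
        (div_nonneg (by linarith) ht1.le) (div_nonneg (by linarith) ht1.le)
        (by field_simp; ring)
      have e1 : (1 - sSup T) / (1 - t) * t + (sSup T - t) / (1 - t) * 1 = sSup T := by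
        field_simp
        ring
      simp only [e1, hf1, ht.2, mul_zero, add_zero] at h
      rw [div_mul_eq_mul_div, div_le_iff₀ ht1] at h
      rw [le_div_iff₀ (by linarith)]
      linarith
    rw [le_div_iff₀ (by linarith)] at hsup
    nlinarith
  refine ⟨sSup T, ⟨hb0, hb1⟩, fun p hp => ⟨fun h => ?_, fun h => ?_⟩⟩
  · by_contra! hcon
    exact h.ne (hdown _ hmem p hp.1 hcon).2
  · refine lt_of_le_of_ne (hle p (hIcc p hp)) fun heq => ?_
    exact absurd (le_csSup hbdd (show p ∈ T from ⟨hp, heq⟩)) (not_le.2 h)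

/-- The set where a concave function on `[0, 1]` lies strictly below `min p (1 - p)` is an interval
around `1 / 2`. -/
theorem exists_boundaries {f : ℝ → ℝ} (hf : ConcaveOn ℝ (Icc 0 1) f) (hf0 : f 0 = 0)
    (hf1 : f 1 = 0) (hle : ∀ p ∈ Icc (0 : ℝ) 1, f p ≤ min p (1 - p)) :
    ∃ b₁ ∈ Icc (0 : ℝ) (1 / 2), ∃ b₂ ∈ Icc (1 / 2 : ℝ) 1,
      ∀ p, p ∈ Icc (0 : ℝ) 1 ∧ f p < min p (1 - p) ↔ b₁ < p ∧ p < b₂ := by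
  -- The right boundary is the left boundary of the reflected function.
  have hf' : ConcaveOn ℝ (Icc 0 1) fun p => f (1 - p) := by
    refine ⟨convex_Icc 0 1, fun p hp r hr a b ha hb hab => ?_⟩
    have h := hf.2 (x := 1 - p) (y := 1 - r) ⟨by linarith [hp.2], by linarith [hp.1]⟩
      ⟨by linarith [hr.2], by linarith [hr.1]⟩ ha hb hab
    have e : a • (1 - p) + b • (1 - r) = 1 - (a • p + b • r) := by
      simp only [smul_eq_mul]
      linear_combination hab
    rwa [e] at h
  obtain ⟨b₁, hb₁, h₁⟩ := exists_left_boundary hf hf0 hf1 fun p hp =>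
    (hle p hp).trans (min_le_left _ _)
  obtain ⟨b, hb, h₂⟩ := exists_left_boundary hf' (by simpa using hf1) (by simpa using hf0)
    fun p hp => by
      have := (hle (1 - p) ⟨by linarith [hp.2], by linarith [hp.1]⟩).trans (min_le_right _ _)
      linarith
  have h₂' : ∀ p ∈ Icc (1 / 2 : ℝ) 1, f p < 1 - p ↔ p < 1 - b := fun p hp => by
    have := h₂ (1 - p) ⟨by linarith [hp.2], by linarith [hp.1]⟩
    rw [sub_sub_cancel] at this
    rw [this, lt_sub_comm]
  refine ⟨b₁, hb₁, 1 - b, ⟨by linarith [hb.2], by linarith [hb.1]⟩, fun p => ?_⟩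
  rw [lt_min_iff]
  constructor
  · rintro ⟨hp, hl, hr⟩
    rcases lt_trichotomy p (1 / 2) with h | rfl | h
    · exact ⟨(h₁ p ⟨hp.1, h.le⟩).1 hl, by linarith [hb.2]⟩
    · exact ⟨(h₁ _ ⟨hp.1, le_rfl⟩).1 hl, (h₂' _ ⟨le_rfl, hp.2⟩).1 hr⟩
    · exact ⟨by linarith [hb₁.2], (h₂' p ⟨h.le, hp.2⟩).1 hr⟩
  · rintro ⟨hl, hr⟩
    have hp : p ∈ Icc (0 : ℝ) 1 := ⟨by linarith [hb₁.1], by linarith [hb.1]⟩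
    refine ⟨hp, ?_⟩
    rcases le_total p (1 / 2) with h | h
    · have := (h₁ p ⟨hp.1, h⟩).2 hl
      exact ⟨this, by linarith⟩
    · have := (h₂' p ⟨h, hp.2⟩).2 hr
      exact ⟨by linarith, this⟩

end ConcaveOnUnitInterval

/-! ### Concavity of the value function and the continuation interval. -/

section Value

variable {ν μ : Measure ℝ}

theorem q_level (hν : ν ≠ 0) [SFinite ν] [IsProbabilityMeasure μ]
    (hμ : ∀ᵐ u ∂μ, u ∈ paramSet ν) {θ₀ : ℝ} (hθ : 0 < μ (Ioi θ₀)) (hθ' : 0 < μ (Iic θ₀))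
    {n : ℕ} (ho : IsOpen (finiteSet ν μ n)) {p : ℝ} (hp : p ∈ Ioo (0 : ℝ) 1) :
    q ν μ θ₀ n (level ν μ θ₀ n p) = p :=
  Function.invFun_eq (exists_q_eq hθ hθ' ho (nonempty_finiteSet hν hμ n) hp)

/-- `Function.invFun` could pick a preimage anywhere, but off `finiteSet` the posterior is the zero
measure, so `q` is 0 there and cannot equal p > 0. -/
theorem level_mem (hν : ν ≠ 0) [SFinite ν] [IsProbabilityMeasure μ]
    (hμ : ∀ᵐ u ∂μ, u ∈ paramSet ν) {θ₀ : ℝ} (hθ : 0 < μ (Ioi θ₀)) (hθ' : 0 < μ (Iic θ₀))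
    {n : ℕ} (ho : IsOpen (finiteSet ν μ n)) {p : ℝ} (hp : p ∈ Ioo (0 : ℝ) 1) :
    level ν μ θ₀ n p ∈ finiteSet ν μ n := by
  by_contra hcon
  have := q_level hν hμ hθ hθ' ho hp
  rw [q_of_notMem θ₀ hcon] at this
  exact hp.1.ne this

/-- In the coordinate π = `q`, the value is an infimum of the concave functions `val`. -/
theorem concaveOn_V (hν : ν ≠ 0) [SFinite ν] [IsProbabilityMeasure μ]
    (hμ : ∀ᵐ u ∂μ, u ∈ paramSet ν) {θ₀ : ℝ} (hθ : 0 < μ (Ioi θ₀)) (hθ' : 0 < μ (Iic θ₀))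
    {c : ℝ} (hc : 0 ≤ c) {n : ℕ} (ho : IsOpen (finiteSet ν μ n)) :
    ConcaveOn ℝ (Ioo 0 1) (V ν μ θ₀ c n) := by
  refine ⟨convex_Ioo 0 1, fun p hp r hr a b ha hb hab => ?_⟩
  have hx : a • p + b • r ∈ Ioo (0 : ℝ) 1 := (convex_Ioo (0 : ℝ) 1) hp hr ha hb hab
  have hV : ∀ {p}, p ∈ Ioo (0 : ℝ) 1 → V ν μ θ₀ c n p = ⨅ k, val ν μ θ₀ c k n (level ν μ θ₀ n p) :=
    fun hp => V_eq_iInf_val hν hμ θ₀ hc (level_mem hν hμ hθ hθ' ho hp)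
  have hint : ∀ {p}, p ∈ Ioo (0 : ℝ) 1 → level ν μ θ₀ n p ∈ interior (finiteSet ν μ n) :=
    fun hp => by
      rw [ho.interior_eq]
      exact level_mem hν hμ hθ hθ' ho hp
  have hbd : ∀ y, BddBelow (range fun k => val ν μ θ₀ c k n y) := fun y =>
    ⟨0, by rintro _ ⟨k, rfl⟩; exact val_nonneg θ₀ hc _ _ _⟩
  rw [hV hp, hV hr, hV hx]
  refine le_ciInf fun k => ?_
  refine (add_le_add (mul_le_mul_of_nonneg_left (ciInf_le (hbd _) k) ha)
    (mul_le_mul_of_nonneg_left (ciInf_le (hbd _) k) hb)).trans ?_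
  refine qconcave_val hν hμ hθ hθ' hc k n (hint hx) (hint hp) (hint hr) ha hb hab ?_
  rw [q_level hν hμ hθ hθ' ho hp, q_level hν hμ hθ hθ' ho hr, q_level hν hμ hθ hθ' ho hx]
  rfl

theorem V_nonneg [SFinite ν] (θ₀ c : ℝ) (n : ℕ) (p : ℝ) : 0 ≤ V ν μ θ₀ c n p :=
  ENNReal.toReal_nonneg

theorem V_le_min (hν : ν ≠ 0) [SFinite ν] [IsProbabilityMeasure μ]
    (hμ : ∀ᵐ u ∂μ, u ∈ paramSet ν) {θ₀ : ℝ} (hθ : 0 < μ (Ioi θ₀)) (hθ' : 0 < μ (Iic θ₀))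
    {c : ℝ} (hc : 0 ≤ c) {n : ℕ} (ho : IsOpen (finiteSet ν μ n)) {p : ℝ}
    (hp : p ∈ Ioo (0 : ℝ) 1) : V ν μ θ₀ c n p ≤ min p (1 - p) := by
  rw [V_eq_iInf_val hν hμ θ₀ hc (level_mem hν hμ hθ hθ' ho hp)]
  refine (ciInf_le ⟨0, by rintro _ ⟨k, rfl⟩; exact val_nonneg θ₀ hc _ _ _⟩ 0).trans_eq ?_
  rw [val, stopLoss, q_level hν hμ hθ hθ' ho hp]

theorem concaveOn_Vext (hν : ν ≠ 0) [SFinite ν] [IsProbabilityMeasure μ]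
    (hμ : ∀ᵐ u ∂μ, u ∈ paramSet ν) {θ₀ : ℝ} (hθ : 0 < μ (Ioi θ₀)) (hθ' : 0 < μ (Iic θ₀))
    {c : ℝ} (hc : 0 ≤ c) {n : ℕ} (ho : IsOpen (finiteSet ν μ n)) :
    ConcaveOn ℝ (Icc 0 1) (Vext ν μ θ₀ c n) := by
  have h := concaveOn_Icc_ite (concaveOn_V hν hμ hθ hθ' hc ho) fun p _ => V_nonneg θ₀ c n p
  convert h using 2
  unfold Vext
  split_ifs <;> rfl

theorem exists_boundaries_Vext (hν : ν ≠ 0) [SFinite ν] [IsProbabilityMeasure μ]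
    (hμ : ∀ᵐ u ∂μ, u ∈ paramSet ν) {θ₀ : ℝ} (hθ : 0 < μ (Ioi θ₀)) (hθ' : 0 < μ (Iic θ₀))
    {c : ℝ} (hc : 0 ≤ c) {n : ℕ} (ho : IsOpen (finiteSet ν μ n)) :
    ∃ b₁ ∈ Icc (0 : ℝ) (1 / 2), ∃ b₂ ∈ Icc (1 / 2 : ℝ) 1,
      ∀ p, (n, p) ∈ contRegion ν μ θ₀ c ↔ b₁ < p ∧ p < b₂ := by
  refine exists_boundaries (concaveOn_Vext hν hμ hθ hθ' hc ho) (by simp [Vext]) (by simp [Vext])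
    fun p hp => ?_
  unfold Vext
  split_ifs with h
  · exact le_min hp.1 (sub_nonneg.2 hp.2)
  · push Not at h
    exact V_le_min hν hμ hθ hθ' hc ho
      ⟨lt_of_le_of_ne hp.1 (Ne.symm h.1), lt_of_le_of_ne hp.2 h.2⟩

end Value

end SeqTest

theorem theorem3p1
    (ν : Measure ℝ) [SigmaFinite ν] (hν : ν ≠ 0)
    (μ : Measure ℝ) [IsProbabilityMeasure μ] (hμ : μ (interior (SeqTest.paramSet ν))ᶜ = 0)
    (θ₀ c : ℝ) (hc : 0 < c) (h0 : 0 < μ (Ioi θ₀)) (h1 : μ (Ioi θ₀) < 1) :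
    (∀ n : ℕ, IsOpen (SeqTest.finiteSet ν μ n) →
      ConcaveOn ℝ (Ioo 0 1) (fun p => SeqTest.V ν μ θ₀ c n p) ∧
      ConcaveOn ℝ (Icc 0 1) (fun p => SeqTest.Vext ν μ θ₀ c n p)) ∧
    ∃ b₁ b₂ : ℕ → ℝ,
      (∀ n, b₁ n ∈ Icc (0 : ℝ) (1 / 2) ∧ b₂ n ∈ Icc (1 / 2 : ℝ) 1) ∧
      (∀ n : ℕ, IsOpen (SeqTest.finiteSet ν μ n) →
        {p : ℝ | (n, p) ∈ SeqTest.contRegion ν μ θ₀ c} = {p | b₁ n < p ∧ p < b₂ n}) ∧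
      ((∀ n : ℕ, IsOpen (SeqTest.finiteSet ν μ n)) →
        SeqTest.contRegion ν μ θ₀ c = {z | z.2 ∈ Icc (0 : ℝ) 1 ∧ b₁ z.1 < z.2 ∧ z.2 < b₂ z.1}) := by
  have hμ' : ∀ᵐ u ∂μ, u ∈ SeqTest.paramSet ν := by
    filter_upwards [measure_eq_zero_iff_ae_notMem.1 hμ] with u hu
    exact interior_subset (not_not.1 hu)
  have h1' : 0 < μ (Iic θ₀) := by
    rw [← compl_Ioi, prob_compl_eq_one_sub measurableSet_Ioi]
    exact tsub_pos_of_lt h1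
  refine ⟨fun n ho => ⟨SeqTest.concaveOn_V hν hμ' h0 h1' hc.le ho,
    SeqTest.concaveOn_Vext hν hμ' h0 h1' hc.le ho⟩, ?_⟩
  have hb : ∀ n : ℕ, ∃ b : ℝ × ℝ, (b.1 ∈ Icc (0 : ℝ) (1 / 2) ∧ b.2 ∈ Icc (1 / 2 : ℝ) 1) ∧
      (IsOpen (SeqTest.finiteSet ν μ n) →
        ∀ p, (n, p) ∈ SeqTest.contRegion ν μ θ₀ c ↔ b.1 < p ∧ p < b.2) := by
    intro n
    by_cases ho : IsOpen (SeqTest.finiteSet ν μ n)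
    · obtain ⟨b₁, hb₁, b₂, hb₂, h⟩ := SeqTest.exists_boundaries_Vext hν hμ' h0 h1' hc.le ho
      exact ⟨(b₁, b₂), ⟨hb₁, hb₂⟩, fun _ => h⟩
    -- Where Y_n is not open nothing is claimed about the region, so any admissible boundaries do.
    · exact ⟨(0, 1), by norm_num, fun h => absurd h ho⟩
  choose b hb hreg using hb
  refine ⟨fun n => (b n).1, fun n => (b n).2, hb, fun n ho => Set.ext (hreg n ho), fun ho => ?_⟩
  ext ⟨n, p⟩
  exact ⟨fun h => ⟨h.1, (hreg n (ho n) p).1 h⟩, fun h => (hreg n (ho n) p).2 h.2⟩
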